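/- Let $\ell>0$, let $\sigma\in L^2(0,\ell)$ be complex-valued, and let $q=\sigma'\in W^{-1,2}(0,\ell)$ (distributional derivative; every element of $W^{-1,2}(0,\ell)$ has this form). For $y\in W^{1,2}(0,\ell)$ let $\mathbf S_q y=-y''+qy\in W^{-1,2}(0,\ell)$ be defined by $$(\mathbf S_q y\,|\,\phi)=\int_0^\ell y'\phi'\,dx-\int_0^\ell \sigma\,(y\phi)'\,dx,\qquad \phi\in W^{1,2}_0(0,\ell).$$ Assume that $f\in W^{1,2}(0,\ell)$ satisfies $\mathbf S_q f=0$, $f(x)\neq 0$ for all $x\in[0,\ell]$, and $f(0)=1$. Put $\mathbf D_f y=y'-\frac{f'}{f}y$, and for $\rho\in\mathbb C$ let $e_f(\rho,\cdot)\in W^{1,2}(0,\ell)$ be the unique solution of $\mathbf S_q y=\rho^2y$ with $\mathbf D_f y\in W^{1,2}(0,\ell)$, $y(0)=1$ and $(\mathbf D_f y)(0)=i\rho$ (Sobolev functions being identified with their continuous representatives). Then there is a kernel $K_f$ that is square integrable on the triangle $\{(x,t): 0\le x\le \ell,\ |t|\le x\}$, with $K_f(x,\cdot)\in L^2(-x,x)$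 for every $x\in(0,\ell]$, such that $$e_f(\rho,x)=e^{i\rho x}+\int_{-x}^{x}K_f(x,t)e^{i\rho t}\,dt\qquad (\rho\in\mathbb C,\ 0<x\le \ell).$$ Moreover, for every such kernel, the operator $$\mathbf T_f u(x)=u(x)+\int_{-x}^{x}K_f(x,t)u(t)\,dt,\qquad 0\le x\le \ell,$$ maps $C[-\ell,\ell]$ into $C[0,\ell]$, and $\mathbf T_f$ is a bounded linear operator from $C[-\ell,\ell]$ to $C[0,\ell]$ (complex-valued functions, supremum norms). -/

import Mathlib

open MeasureTheory Set

namespace DistSchrodinger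

/-- `u ∈ W^{1,2}(0,ℓ)` with derivative `u' ∈ L²(0,ℓ)`. As usual in one dimension, `u` stands for
the absolutely continuous representative on `[0,ℓ]`, so that `u` is the primitive of `u'`. -/
structure HasL2Deriv (ℓ : ℝ) (u u' : ℝ → ℂ) : Prop where
  memLp : MemLp u' 2 (volume.restrict (Ioo 0 ℓ))
  eq_integral : ∀ x ∈ Icc 0 ℓ, u x = u 0 + ∫ t in (0 : ℝ)..x, u' t

/-- `y ∈ W^{1,2}(0,ℓ)` solves `-y'' + q y = lam y` on `(0,ℓ)`, where `q = σ' ∈ W^{-1,2}(0,ℓ)` is the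
distributional derivative of `σ ∈ L²(0,ℓ)`. Both sides are functionals on `W_0^{1,2}(0,ℓ)`:
`⟨S_q y, φ⟩ = ∫ y' φ' + ⟨q, y φ⟩ = ∫ y' φ' - ∫ σ (y φ)'`. -/
def SolvesSchrodinger (ℓ : ℝ) (σ : ℝ → ℂ) (lam : ℂ) (y : ℝ → ℂ) : Prop :=
  ∃ y' : ℝ → ℂ, HasL2Deriv ℓ y y' ∧
    ∀ φ φ' : ℝ → ℂ, HasL2Deriv ℓ φ φ' → φ 0 = 0 → φ ℓ = 0 →
      (∫ x in (0 : ℝ)..ℓ, y' x * φ' x) - (∫ x in (0 : ℝ)..ℓ, σ x * (y' x * φ x + y x * φ' x))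
        = lam * ∫ x in (0 : ℝ)..ℓ, y x * φ x

/-- `v` is the continuous representative of `D_f y = y' - (f'/f) y`, and `v ∈ W^{1,2}(0,ℓ)`. -/
def IsQuasiDeriv (ℓ : ℝ) (f y v : ℝ → ℂ) : Prop :=
  (∃ f' y' : ℝ → ℂ, HasL2Deriv ℓ f f' ∧ HasL2Deriv ℓ y y' ∧
    ∀ᵐ x ∂(volume.restrict (Ioo 0 ℓ)), v x = y' x - f' x / f x * y x) ∧
  ∃ v' : ℝ → ℂ, HasL2Deriv ℓ v v'

/-- `f` is a nonvanishing solution of `S_q f = 0`, `q = σ'`, normalized by `f(0) = 1`. -/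
structure IsNonvanishingSolution (ℓ : ℝ) (σ f : ℝ → ℂ) : Prop where
  solves : SolvesSchrodinger ℓ σ 0 f
  ne_zero : ∀ x ∈ Icc 0 ℓ, f x ≠ 0
  normalized : f 0 = 1

/-- `y = e_f(ρ, ·)`: the solution of `S_q y = ρ² y` with `y(0) = 1` and `(D_f y)(0) = iρ`. -/
structure IsExpSolution (ℓ : ℝ) (σ f : ℝ → ℂ) (ρ : ℂ) (y : ℝ → ℂ) : Prop where
  solves : SolvesSchrodinger ℓ σ (ρ ^ 2) y
  init : y 0 = 1
  init_quasi : ∃ v : ℝ → ℂ, IsQuasiDeriv ℓ f y v ∧ v 0 = Complex.I * ρ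

/-- The operator `u ↦ u(x) + ∫_{-x}^{x} K(x,t) u(t) dt`. -/
noncomputable def transmutation (K : ℝ → ℝ → ℂ) (u : ℝ → ℂ) (x : ℝ) : ℂ :=
  u x + ∫ t in (-x)..x, K x t * u t

/-- The triangle `0 ≤ x ≤ ℓ`, `|t| ≤ x`. -/
def triangle (ℓ : ℝ) : Set (ℝ × ℝ) := {p | 0 ≤ p.1 ∧ p.1 ≤ ℓ ∧ |p.2| ≤ p.1}

/-- `K` is the transmutation kernel `K_f`: it is square integrable on the triangle and on each
slice, and `e_f(ρ,x) = e^{iρx} + ∫_{-x}^{x} K(x,t) e^{iρt} dt` for all `ρ ∈ ℂ`, `0 < x ≤ ℓ`. -/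
structure IsTransmutationKernel (ℓ : ℝ) (σ f : ℝ → ℂ) (K : ℝ → ℝ → ℂ) : Prop where
  memLp : MemLp (fun p : ℝ × ℝ => K p.1 p.2) 2 (volume.restrict (triangle ℓ))
  memLp_slice : ∀ x ∈ Ioc 0 ℓ, MemLp (K x) 2 (volume.restrict (Ioo (-x) x))
  repr : ∀ ρ : ℂ, ∃ e : ℝ → ℂ, IsExpSolution ℓ σ f ρ e ∧
    ∀ x ∈ Ioc 0 ℓ, e x = transmutation K (fun t => Complex.exp (Complex.I * ρ * t)) x

end DistSchrodinger

/-!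
With `h = f'/f ∈ L²(0,ℓ)` the equation `S_q y = ρ² y` becomes, for `v = D_f y`, the first-order
system `y' = h y + v`, `v' = -h v - ρ² y`. Diagonalizing its free part leads to functions `J_ρ`
with `J_ρ' = -iρ J_ρ + h J_{-ρ}` and `J_ρ(0) = 1`, and `e_f(ρ, ·)` is a linear combination of the
`J_{±ρ}` of `h` and of `-h`. These functions have the form
`J_ρ(x) = e^{-iρx} (1 + ∫ S(x,t) e^{iρt} dt)`, where `S` solves the Volterra equation
`S(x,t) = h(t/2)/2 + ∫_0^x h(s) S(s, 2s - t) ds`, hence `K_f` is a combination of translates of `S`.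

Any two kernels act alike on the exponentials `e^{irt}`, `r ∈ ℝ`, hence on all continuous functions,
since the exponentials span a dense subspace of `C[-x,x]`. The functionals `u ↦ (T_f u)(x)` are
uniformly bounded because the slices `K_f(x, ·)` are bounded in `L¹`, and they depend continuously
on `x` when `u` is an exponential, because `T_f e^{iρ·} = e_f(ρ, ·)`; by density they do for every
`u`.
-/

namespace DistSchrodinger

open Filter Topology

section AbsolutelyContinuous

variable {X Y E : Type*} [PseudoMetricSpace X] [PseudoMetricSpace Y] [NormedAddCommGroup E]
  [NormedSpace ℝ E] {a b : ℝ}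

lemma absolutelyContinuousOnInterval_of_dist_le {f : ℝ → X} {g : ℝ → Y}
    (hf : AbsolutelyContinuousOnInterval f a b) (C : ℝ)
    (h : ∀ x ∈ uIcc a b, ∀ y ∈ uIcc a b, dist (g x) (g y) ≤ C * dist (f x) (f y)) :
    AbsolutelyContinuousOnInterval g a b := by
  have hCf := Filter.Tendsto.const_mul C hf
  rw [mul_zero] at hCf
  refine squeeze_zero' (Eventually.of_forall fun _ => Finset.sum_nonneg fun _ _ => dist_nonneg)
    ?_ hCf
  rw [eventually_inf_principal]
  refine Eventually.of_forall fun I hI => ?_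
  rw [Finset.mul_sum]
  exact Finset.sum_le_sum fun i hi => h _ (hI.1 i hi).1 _ (hI.1 i hi).2

lemma absolutelyContinuousOnInterval_primitive {g : ℝ → E}
    (hg : IntervalIntegrable g volume a b) :
    AbsolutelyContinuousOnInterval (fun x => ∫ t in a..x, g t) a b := by
  refine absolutelyContinuousOnInterval_of_dist_le
    (hg.norm.absolutelyContinuousOnInterval_intervalIntegral left_mem_uIcc) 1 fun x hx y hy => ?_
  have hga : ∀ z ∈ uIcc a b, IntervalIntegrable g volume a z := fun z hz =>
    hg.mono_set (uIcc_subset_uIcc left_mem_uIcc hz)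
  rw [one_mul, dist_eq_norm, dist_eq_norm,
    intervalIntegral.integral_interval_sub_left (hga x hx) (hga y hy),
    intervalIntegral.integral_interval_sub_left (hga x hx).norm (hga y hy).norm, Real.norm_eq_abs]
  exact intervalIntegral.norm_integral_le_abs_integral_norm

end AbsolutelyContinuous

section IntervalMemLp

variable {E : Type*} [NormedAddCommGroup E] {u w : ℝ → E} {p : ENNReal} {a b x y : ℝ}

lemma intervalIntegrable_of_memLp_Ioo (h : MemLp u p (volume.restrict (Ioo a b))) (hp : 1 ≤ p)
    (hx : x ∈ Icc a b) (hy : y ∈ Icc a b) : IntervalIntegrable u volume x y := by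
  have hab : IntervalIntegrable u volume a b :=
    (intervalIntegrable_iff_integrableOn_Ioo_of_le (hx.1.trans hx.2)).2 (h.integrable hp)
  exact hab.mono_set (uIcc_subset_uIcc (Icc_subset_uIcc hx) (Icc_subset_uIcc hy))

lemma memLp_Ioo_of_continuousOn (hu : ContinuousOn u (Icc a b)) (p : ENNReal) :
    MemLp u p (volume.restrict (Ioo a b)) := by
  obtain ⟨C, hC⟩ := isCompact_Icc.exists_bound_of_continuousOn hu
  refine MemLp.of_bound ((hu.mono Ioo_subset_Icc_self).aestronglyMeasurable measurableSet_Ioo) C ?_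
  filter_upwards [ae_restrict_mem measurableSet_Ioo] with x hx
  exact hC x (Ioo_subset_Icc_self hx)

lemma memLp_Ioo_continuousOn_mul {R : Type*} [NormedRing R] {u w : ℝ → R}
    (hu : ContinuousOn u (Icc a b)) (hw : MemLp w p (volume.restrict (Ioo a b))) :
    MemLp (fun x => u x * w x) p (volume.restrict (Ioo a b)) :=
  hw.mul (memLp_Ioo_of_continuousOn hu ⊤)

lemma intervalIntegral_congr_ae_Ioo [NormedSpace ℝ E]
    (h : u =ᵐ[volume.restrict (Ioo a b)] w) (hx : x ∈ Icc a b) :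
    ∫ t in a..x, u t = ∫ t in a..x, w t := by
  refine intervalIntegral.integral_congr_ae ?_
  rw [EventuallyEq, ae_restrict_iff' measurableSet_Ioo] at h
  filter_upwards [h, (volume : Measure ℝ).ae_ne b] with t ht htb htx
  rw [uIoc_of_le hx.1] at htx
  exact ht ⟨htx.1, (htx.2.trans hx.2).lt_of_ne htb⟩

end IntervalMemLp

section Sobolev

variable {ℓ x : ℝ} {u u' w w' : ℝ → ℂ}

lemma HasL2Deriv.intervalIntegrable (hu : HasL2Deriv ℓ u u') (hx : x ∈ Icc 0 ℓ) :
    IntervalIntegrable u' volume 0 x :=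
  intervalIntegrable_of_memLp_Ioo hu.memLp one_le_two ⟨le_rfl, hx.1.trans hx.2⟩ hx

lemma HasL2Deriv.absolutelyContinuousOnInterval (hu : HasL2Deriv ℓ u u') (hx : x ∈ Icc 0 ℓ) :
    AbsolutelyContinuousOnInterval u 0 x := by
  refine absolutelyContinuousOnInterval_of_dist_le
    (absolutelyContinuousOnInterval_primitive (hu.intervalIntegrable hx)) 1 fun y hy z hz => ?_
  rw [uIcc_of_le hx.1] at hy hz
  rw [hu.eq_integral y ⟨hy.1, hy.2.trans hx.2⟩, hu.eq_integral z ⟨hz.1, hz.2.trans hx.2⟩, one_mul,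
    dist_add_left]

lemma HasL2Deriv.continuousOn (hu : HasL2Deriv ℓ u u') : ContinuousOn u (Icc 0 ℓ) := by
  rcases lt_or_ge ℓ 0 with hℓ | hℓ
  · simp [Icc_eq_empty hℓ.not_ge]
  · simpa only [uIcc_of_le hℓ] using (hu.absolutelyContinuousOnInterval ⟨hℓ, le_rfl⟩).continuousOn

lemma HasL2Deriv.ae_hasDerivAt (hu : HasL2Deriv ℓ u u') :
    ∀ᵐ x, x ∈ Ioo 0 ℓ → HasDerivAt u (u' x) x := by
  rcases lt_or_ge ℓ 0 with hℓ | hℓ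
  · simp [Ioo_eq_empty hℓ.not_gt]
  filter_upwards [(hu.intervalIntegrable ⟨hℓ, le_rfl⟩).ae_hasDerivAt_integral] with x hx hxI
  rw [uIcc_of_le hℓ] at hx
  refine ((hx (Ioo_subset_Icc_self hxI) 0 ⟨le_rfl, hℓ⟩).const_add (u 0)).congr_of_eventuallyEq ?_
  filter_upwards [isOpen_Ioo.mem_nhds hxI] with y hy
  exact hu.eq_integral y (Ioo_subset_Icc_self hy)

lemma hasL2Deriv_of_absolutelyContinuousOnInterval
    (hu' : MemLp u' 2 (volume.restrict (Ioo 0 ℓ)))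
    (hu : ∀ x ∈ Icc 0 ℓ, AbsolutelyContinuousOnInterval u 0 x)
    (hd : ∀ᵐ x, x ∈ Ioo 0 ℓ → HasDerivAt u (u' x) x) : HasL2Deriv ℓ u u' := by
  refine ⟨hu', fun x hx => ?_⟩
  have hint : IntervalIntegrable u' volume 0 x :=
    intervalIntegrable_of_memLp_Ioo hu' one_le_two ⟨le_rfl, hx.1.trans hx.2⟩ hx
  have hzero : ∀ᵐ y, y ∈ uIcc 0 x → HasDerivAt (fun y => u y - ∫ t in (0 : ℝ)..y, u' t) 0 y := by
    filter_upwards [hd, hint.ae_hasDerivAt_integral, (volume : Measure ℝ).ae_ne 0,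
      (volume : Measure ℝ).ae_ne ℓ] with y hu hI hy0 hyℓ hy
    have hy' := uIcc_of_le hx.1 ▸ hy
    exact sub_self (u' y) ▸ (hu ⟨hy'.1.lt_of_ne' hy0, (hy'.2.trans hx.2).lt_of_ne hyℓ⟩).fun_sub
      (hI hy 0 left_mem_uIcc)
  obtain ⟨C, hC⟩ := ((hu x hx).fun_sub
    (absolutelyContinuousOnInterval_primitive hint)).const_of_ae_hasDerivAt_zero hzero
  have hC0 := hC 0 left_mem_uIcc
  rw [intervalIntegral.integral_same, sub_zero] at hC0
  rw [hC0, ← hC x right_mem_uIcc, sub_add_cancel]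

lemma HasL2Deriv.add (hu : HasL2Deriv ℓ u u') (hw : HasL2Deriv ℓ w w') :
    HasL2Deriv ℓ (fun x => u x + w x) (fun x => u' x + w' x) := by
  refine ⟨hu.memLp.add hw.memLp, fun x hx => ?_⟩
  rw [hu.eq_integral x hx, hw.eq_integral x hx,
    intervalIntegral.integral_add (hu.intervalIntegrable hx) (hw.intervalIntegrable hx)]
  ring

lemma HasL2Deriv.const_mul (c : ℂ) (hu : HasL2Deriv ℓ u u') :
    HasL2Deriv ℓ (fun x => c * u x) (fun x => c * u' x) := by
  refine ⟨hu.memLp.const_mul c, fun x hx => ?_⟩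
  rw [hu.eq_integral x hx, intervalIntegral.integral_const_mul, mul_add]

lemma HasL2Deriv.sub (hu : HasL2Deriv ℓ u u') (hw : HasL2Deriv ℓ w w') :
    HasL2Deriv ℓ (fun x => u x - w x) (fun x => u' x - w' x) := by
  simpa [sub_eq_add_neg] using hu.add (hw.const_mul (-1))

lemma HasL2Deriv.mul (hu : HasL2Deriv ℓ u u') (hw : HasL2Deriv ℓ w w') :
    HasL2Deriv ℓ (fun x => u x * w x) (fun x => u' x * w x + u x * w' x) := by
  refine hasL2Deriv_of_absolutelyContinuousOnInterval ?_ (fun x hx => ?_) ?_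
  · have hwu' := memLp_Ioo_continuousOn_mul hw.continuousOn hu.memLp
    simp only [mul_comm (w _)] at hwu'
    exact hwu'.add (memLp_Ioo_continuousOn_mul hu.continuousOn hw.memLp)
  · exact (hu.absolutelyContinuousOnInterval hx).fun_smul (hw.absolutelyContinuousOnInterval hx)
  · filter_upwards [hu.ae_hasDerivAt, hw.ae_hasDerivAt] with x hux hwx hx
    exact (hux hx).mul (hwx hx)

lemma HasL2Deriv.inv (hu : HasL2Deriv ℓ u u') (h0 : ∀ x ∈ Icc 0 ℓ, u x ≠ 0) :
    HasL2Deriv ℓ (fun x => (u x)⁻¹) (fun x => -u' x / u x ^ 2) := by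
  have hinv : ContinuousOn (fun x => (u x)⁻¹) (Icc 0 ℓ) := hu.continuousOn.inv₀ h0
  obtain ⟨C, hC⟩ := isCompact_Icc.exists_bound_of_continuousOn hinv
  refine hasL2Deriv_of_absolutelyContinuousOnInterval ?_ (fun x hx =>
    absolutelyContinuousOnInterval_of_dist_le (hu.absolutelyContinuousOnInterval hx) (C * C)
      fun y hy z hz => ?_) ?_
  · convert (memLp_Ioo_continuousOn_mul (hinv.pow 2) hu.memLp).const_mul (-1) using 2 with x
    simp only [Pi.pow_apply]
    ring
  · have hsub : uIcc 0 x ⊆ Icc 0 ℓ := uIcc_of_le hx.1 ▸ Icc_subset_Icc_right hx.2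
    have hC0 : 0 ≤ C := (norm_nonneg _).trans (hC x hx)
    rw [dist_inv_inv₀ (h0 y (hsub hy)) (h0 z (hsub hz)), div_eq_inv_mul, mul_inv, ← norm_inv,
      ← norm_inv]
    gcongr
    exacts [hC y (hsub hy), hC z (hsub hz)]
  · filter_upwards [hu.ae_hasDerivAt] with x hux hx
    exact (hux hx).inv (h0 x (Ioo_subset_Icc_self hx))

lemma HasL2Deriv.ae_unique (hu : HasL2Deriv ℓ u u') (hw : HasL2Deriv ℓ u w') :
    u' =ᵐ[volume.restrict (Ioo 0 ℓ)] w' := by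
  rw [EventuallyEq, ae_restrict_iff' measurableSet_Ioo]
  filter_upwards [hu.ae_hasDerivAt, hw.ae_hasDerivAt] with x hux hwx hx
  exact (hux hx).unique (hwx hx)

lemma HasL2Deriv.congr_deriv (hu : HasL2Deriv ℓ u u')
    (h : u' =ᵐ[volume.restrict (Ioo 0 ℓ)] w') : HasL2Deriv ℓ u w' :=
  ⟨hu.memLp.ae_eq h, fun x hx => by
    rw [hu.eq_integral x hx, intervalIntegral_congr_ae_Ioo h hx]⟩

lemma hasL2Deriv_of_contDiff (hu : ContDiff ℝ 1 u) : HasL2Deriv ℓ u (deriv u) := by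
  have hu' := hu.continuous_deriv le_rfl
  refine ⟨memLp_Ioo_of_continuousOn hu'.continuousOn 2, fun x _ => ?_⟩
  rw [intervalIntegral.integral_deriv_eq_sub (fun y _ => hu.differentiable one_ne_zero y)
    (hu'.intervalIntegrable _ _), add_sub_cancel]

end Sobolev

section Wronskian

variable {ℓ : ℝ} {σ f f' y y' u u' φ φ' ψ ψ' v v' W W' : ℝ → ℂ} {lam ρ : ℂ}

lemma intervalIntegrable_mul_of_memLp_two (hℓ : 0 ≤ ℓ)
    (hu : MemLp u 2 (volume.restrict (Ioo 0 ℓ))) (hφ : MemLp φ 2 (volume.restrict (Ioo 0 ℓ))) :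
    IntervalIntegrable (fun x => u x * φ x) volume 0 ℓ :=
  (intervalIntegrable_iff_integrableOn_Ioo_of_le hℓ).2 (hu.integrable_mul hφ)

lemma HasL2Deriv.integral_mul_deriv_eq_neg (hℓ : 0 ≤ ℓ) (hu : HasL2Deriv ℓ u u')
    (hφ : HasL2Deriv ℓ φ φ') (hφ0 : φ 0 = 0) (hφℓ : φ ℓ = 0) :
    ∫ x in (0 : ℝ)..ℓ, u x * φ' x = -∫ x in (0 : ℝ)..ℓ, u' x * φ x := by
  have hparts := (hu.mul hφ).eq_integral ℓ ⟨hℓ, le_rfl⟩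
  rw [hφ0, hφℓ, mul_zero, mul_zero, zero_add, intervalIntegral.integral_add
    (intervalIntegrable_mul_of_memLp_two hℓ hu.memLp (memLp_Ioo_of_continuousOn hφ.continuousOn 2))
    (intervalIntegrable_mul_of_memLp_two hℓ (memLp_Ioo_of_continuousOn hu.continuousOn 2)
      hφ.memLp)] at hparts
  linear_combination -hparts

lemma SolvesSchrodinger.weak_eq (hℓ : 0 ≤ ℓ) (hs : SolvesSchrodinger ℓ σ lam y)
    (hy : HasL2Deriv ℓ y y') (hφ : HasL2Deriv ℓ φ φ') (hφ0 : φ 0 = 0) (hφℓ : φ ℓ = 0) :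
    (∫ x in (0 : ℝ)..ℓ, y' x * φ' x) - (∫ x in (0 : ℝ)..ℓ, σ x * (y' x * φ x + y x * φ' x)) =
      lam * ∫ x in (0 : ℝ)..ℓ, y x * φ x := by
  obtain ⟨z', hz, hweak⟩ := hs
  rw [← hweak φ φ' hφ hφ0 hφℓ]
  congr 1 <;> refine intervalIntegral_congr_ae_Ioo ?_ ⟨hℓ, le_rfl⟩ <;>
    filter_upwards [hy.ae_unique hz] with x hx <;> rw [hx]

/- Testing the equation of `f` with `y ψ` and subtracting removes `σ`, since `y (f ψ) = f (y ψ)`. -/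
lemma SolvesSchrodinger.weakForm_mul_eq_integral_wronskian (hℓ : 0 ≤ ℓ)
    (hs : SolvesSchrodinger ℓ σ 0 f) (hf : HasL2Deriv ℓ f f') (hy : HasL2Deriv ℓ y y')
    (hψ : HasL2Deriv ℓ ψ ψ') (hψ0 : ψ 0 = 0) (hψℓ : ψ ℓ = 0) :
    (∫ x in (0 : ℝ)..ℓ, y' x * (f' x * ψ x + f x * ψ' x)) -
      (∫ x in (0 : ℝ)..ℓ, σ x * (y' x * (f x * ψ x) + y x * (f' x * ψ x + f x * ψ' x))) =
      ∫ x in (0 : ℝ)..ℓ, (f x * y' x - f' x * y x) * ψ' x := by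
  have hfyψ := hs.weak_eq hℓ hf (hy.mul hψ) (by rw [hψ0, mul_zero]) (by rw [hψℓ, mul_zero])
  have hσ : (fun x => σ x * (y' x * (f x * ψ x) + y x * (f' x * ψ x + f x * ψ' x))) =
      fun x => σ x * (f' x * (y x * ψ x) + f x * (y' x * ψ x + y x * ψ' x)) := by
    ext x; ring
  rw [zero_mul, sub_eq_zero] at hfyψ
  rw [hσ, ← hfyψ, ← intervalIntegral.integral_sub
    (intervalIntegrable_mul_of_memLp_two hℓ hy.memLp (hf.mul hψ).memLp)
    (intervalIntegrable_mul_of_memLp_two hℓ hf.memLp (hy.mul hψ).memLp)]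
  congr 1 with x
  ring

lemma ae_eq_zero_of_integral_mul_eq_zero (hℓ : 0 ≤ ℓ) (hu : IntervalIntegrable u volume 0 ℓ)
    (h : ∀ φ φ' : ℝ → ℂ, HasL2Deriv ℓ φ φ' → φ 0 = 0 → φ ℓ = 0 →
      ∫ x in (0 : ℝ)..ℓ, u x * φ x = 0) : ∀ᵐ x ∂volume.restrict (Ioo 0 ℓ), u x = 0 := by
  rw [ae_restrict_iff' measurableSet_Ioo]
  refine isOpen_Ioo.ae_eq_zero_of_integral_contDiff_smul_eq_zero
    ((intervalIntegrable_iff_integrableOn_Ioo_of_le hℓ).1 hu).locallyIntegrableOn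
    fun φ hφ _ hsupp => ?_
  have hφ0 : ∀ x, x ∉ Ioo 0 ℓ → φ x = 0 := fun x hx =>
    image_eq_zero_of_notMem_tsupport fun hmem => hx (hsupp hmem)
  have hφC : ContDiff ℝ 1 (fun x => (φ x : ℂ)) :=
    Complex.ofRealCLM.contDiff.comp (hφ.of_le (by exact_mod_cast le_top))
  have huφ := h _ _ (hasL2Deriv_of_contDiff (ℓ := ℓ) hφC) (by simp [hφ0 0]) (by simp [hφ0 ℓ])
  rw [intervalIntegral.integral_of_le hℓ, integral_Ioc_eq_integral_Ioo] at huφ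
  rw [← huφ, ← setIntegral_eq_integral_of_forall_compl_eq_zero (s := Ioo 0 ℓ)
    fun x hx => by simp [hφ0 x hx]]
  simp only [Complex.real_smul, mul_comm]

lemma solvesSchrodinger_of_wronskian (hℓ : 0 ≤ ℓ) (hs : SolvesSchrodinger ℓ σ 0 f)
    (hf0 : ∀ x ∈ Icc 0 ℓ, f x ≠ 0) (hf : HasL2Deriv ℓ f f') (hy : HasL2Deriv ℓ y y')
    (hW : HasL2Deriv ℓ W fun x => -lam * (f x * y x))
    (hWy : ∀ᵐ x ∂volume.restrict (Ioo 0 ℓ), W x = f x * y' x - f' x * y x) :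
    SolvesSchrodinger ℓ σ lam y := by
  refine ⟨y', hy, fun φ φ' hφ hφ0 hφℓ => ?_⟩
  have hψ := hφ.mul (hf.inv hf0)
  have hfψ := hs.weakForm_mul_eq_integral_wronskian hℓ hf hy hψ (by simp [hφ0]) (by simp [hφℓ])
  have hmul : ∀ x ∈ uIcc 0 ℓ, f x * (φ x * (f x)⁻¹) = φ x := fun x hx => by
    field_simp [hf0 x (uIcc_of_le hℓ ▸ hx)]
  have hmul' : ∀ x ∈ uIcc 0 ℓ, f' x * (φ x * (f x)⁻¹) +
      f x * (φ' x * (f x)⁻¹ + φ x * (-f' x / f x ^ 2)) = φ' x := fun x hx => by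
    field_simp [hf0 x (uIcc_of_le hℓ ▸ hx)]
    ring
  calc _ = _ := by
        congr 1 <;> refine intervalIntegral.integral_congr fun x hx => ?_ <;>
          simp only [hmul x hx, hmul' x hx]
    _ = _ := hfψ
    _ = ∫ x in (0 : ℝ)..ℓ, W x * (φ' x * (f x)⁻¹ + φ x * (-f' x / f x ^ 2)) := by
        refine intervalIntegral_congr_ae_Ioo ?_ ⟨hℓ, le_rfl⟩
        filter_upwards [hWy] with x hx
        rw [hx]
    _ = -∫ x in (0 : ℝ)..ℓ, -lam * (f x * y x) * (φ x * (f x)⁻¹) :=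
        hW.integral_mul_deriv_eq_neg hℓ hψ (by simp [hφ0]) (by simp [hφℓ])
    _ = lam * ∫ x in (0 : ℝ)..ℓ, y x * φ x := by
        rw [← intervalIntegral.integral_neg, ← intervalIntegral.integral_const_mul]
        refine intervalIntegral.integral_congr fun x hx => ?_
        linear_combination lam * y x * hmul x hx

lemma SolvesSchrodinger.hasL2Deriv_wronskian (hℓ : 0 ≤ ℓ) (hs : SolvesSchrodinger ℓ σ 0 f)
    (hf : HasL2Deriv ℓ f f') (hys : SolvesSchrodinger ℓ σ lam y) (hy : HasL2Deriv ℓ y y')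
    (hW : HasL2Deriv ℓ W W')
    (hWy : ∀ᵐ x ∂volume.restrict (Ioo 0 ℓ), W x = f x * y' x - f' x * y x) :
    HasL2Deriv ℓ W fun x => -lam * (f x * y x) := by
  have hfy : MemLp (fun x => f x * y x) 2 (volume.restrict (Ioo 0 ℓ)) :=
    memLp_Ioo_of_continuousOn (hf.continuousOn.mul hy.continuousOn) 2
  have hzero := ae_eq_zero_of_integral_mul_eq_zero (u := fun x => W' x + lam * (f x * y x)) hℓ
    (intervalIntegrable_of_memLp_Ioo (hW.memLp.add (hfy.const_mul lam)) one_le_two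
      ⟨le_rfl, hℓ⟩ ⟨hℓ, le_rfl⟩) fun ψ ψ' hψ hψ0 hψℓ => ?_
  · refine hW.congr_deriv ?_
    filter_upwards [hzero] with x hx
    linear_combination hx
  have hψ2 := memLp_Ioo_of_continuousOn hψ.continuousOn 2
  have hweak := hys.weak_eq hℓ hy (hf.mul hψ) (by simp [hψ0]) (by simp [hψℓ])
  have hWψ : ∫ x in (0 : ℝ)..ℓ, (f x * y' x - f' x * y x) * ψ' x =
      ∫ x in (0 : ℝ)..ℓ, W x * ψ' x := by
    refine intervalIntegral_congr_ae_Ioo ?_ ⟨hℓ, le_rfl⟩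
    filter_upwards [hWy] with x hx
    rw [hx]
  rw [hs.weakForm_mul_eq_integral_wronskian hℓ hf hy hψ hψ0 hψℓ, hWψ,
    hW.integral_mul_deriv_eq_neg hℓ hψ hψ0 hψℓ] at hweak
  calc ∫ x in (0 : ℝ)..ℓ, (W' x + lam * (f x * y x)) * ψ x
      = ∫ x in (0 : ℝ)..ℓ, (W' x * ψ x + lam * (y x * (f x * ψ x))) := by
        congr 1 with x; ring
    _ = 0 := by
        rw [intervalIntegral.integral_add (intervalIntegrable_mul_of_memLp_two hℓ hW.memLp hψ2),
          intervalIntegral.integral_const_mul]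
        · linear_combination -hweak
        · exact (intervalIntegrable_mul_of_memLp_two hℓ
            (memLp_Ioo_of_continuousOn hy.continuousOn 2)
            (memLp_Ioo_of_continuousOn (hf.mul hψ).continuousOn 2)).const_mul lam

lemma HasL2Deriv.hasDerivWithinAt_Ici (hu : HasL2Deriv ℓ u u') (hu' : ContinuousOn u' (Icc 0 ℓ))
    {x : ℝ} (hx : x ∈ Ico 0 ℓ) : HasDerivWithinAt u (u' x) (Ici x) x := by
  have hnhds : Icc 0 ℓ ∈ 𝓝[>] x :=
    mem_of_superset (Icc_mem_nhdsGT hx.2) (Icc_subset_Icc_left hx.1)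
  have hx' := Ico_subset_Icc_self hx
  have hprim := intervalIntegral.integral_hasDerivWithinAt_right (s := Ici x) (t := Ioi x)
    (hu.intervalIntegrable hx')
    ⟨Icc 0 ℓ, hnhds, hu'.aestronglyMeasurable measurableSet_Icc⟩
    ((hu' x hx').mono_of_mem_nhdsWithin hnhds)
  refine (hprim.const_add (u 0)).congr_of_eventuallyEq ?_ (hu.eq_integral x hx')
  filter_upwards [Icc_mem_nhdsGE hx.2] with t ht
  exact hu.eq_integral t ⟨hx.1.trans ht.1, ht.2⟩

lemma eqOn_zero_of_hasL2Deriv_mul {a b : ℝ → ℂ} (ha : ContinuousOn a (Icc 0 ℓ))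
    (hb : ContinuousOn b (Icc 0 ℓ)) (hu : HasL2Deriv ℓ u fun x => a x * W x)
    (hW : HasL2Deriv ℓ W fun x => b x * u x) (hu0 : u 0 = 0) (hW0 : W 0 = 0) :
    EqOn u 0 (Icc 0 ℓ) := by
  obtain ⟨A, hA⟩ := isCompact_Icc.exists_bound_of_continuousOn ha
  obtain ⟨B, hB⟩ := isCompact_Icc.exists_bound_of_continuousOn hb
  intro x hx
  have hzero := eq_zero_of_abs_deriv_le_mul_abs_self_of_eq_zero_right (K := max A B)
    (hu.continuousOn.prodMk hW.continuousOn)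
    (fun t ht => (hu.hasDerivWithinAt_Ici (ha.mul hW.continuousOn) ht).prodMk
      (hW.hasDerivWithinAt_Ici (hb.mul hu.continuousOn) ht))
    (by rw [hu0, hW0]; rfl) (fun t ht => ?_) x hx
  · exact congrArg Prod.fst hzero
  have hAt := hA t (Ico_subset_Icc_self ht)
  have hBt := hB t (Ico_subset_Icc_self ht)
  have hK : 0 ≤ max A B := (norm_nonneg _).trans (hAt.trans (le_max_left _ _))
  rw [Prod.norm_def, Prod.norm_def, norm_mul, norm_mul]
  exact max_le
    (mul_le_mul (hAt.trans (le_max_left _ _)) (le_max_right _ _) (norm_nonneg _) hK)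
    (mul_le_mul (hBt.trans (le_max_right _ _)) (le_max_left _ _) (norm_nonneg _) hK)

lemma isExpSolution_of_hasL2Deriv (hℓ : 0 ≤ ℓ) (hf : IsNonvanishingSolution ℓ σ f)
    (hf' : HasL2Deriv ℓ f f') {h : ℝ → ℂ}
    (hh : h =ᵐ[volume.restrict (Ioo 0 ℓ)] fun x => f' x / f x)
    (hy : HasL2Deriv ℓ y fun x => h x * y x + v x)
    (hv : HasL2Deriv ℓ v fun x => -(h x * v x) - ρ ^ 2 * y x) (hy0 : y 0 = 1)
    (hv0 : v 0 = Complex.I * ρ) : IsExpSolution ℓ σ f ρ y := by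
  have hfh : ∀ᵐ x ∂volume.restrict (Ioo 0 ℓ), f x * h x = f' x := by
    filter_upwards [hh, ae_restrict_mem measurableSet_Ioo] with x hx hxℓ
    rw [hx, mul_div_cancel₀ _ (hf.ne_zero x (Ioo_subset_Icc_self hxℓ))]
  refine ⟨solvesSchrodinger_of_wronskian hℓ hf.solves hf.ne_zero hf' hy
    ((hf'.mul hv).congr_deriv ?_) ?_, hy0, v, ⟨⟨f', _, hf', hy, ?_⟩, _, hv⟩, hv0⟩
  · filter_upwards [hfh] with x hx
    rw [← hx]; ring
  · filter_upwards [hfh] with x hx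
    rw [← hx]; ring
  · filter_upwards [hh] with x hx
    rw [hx]; ring

lemma IsExpSolution.exists_wronskian (hℓ : 0 ≤ ℓ) (hf : IsNonvanishingSolution ℓ σ f)
    (hy : IsExpSolution ℓ σ f ρ y) :
    ∃ W, W 0 = Complex.I * ρ ∧ HasL2Deriv ℓ W (fun x => -ρ ^ 2 * (f x * y x)) ∧
      HasL2Deriv ℓ (fun x => y x * (f x)⁻¹) (fun x => (f x ^ 2)⁻¹ * W x) := by
  obtain ⟨v, ⟨⟨f', y', hf', hy', hvy⟩, v', hv⟩, hv0⟩ := hy.init_quasi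
  have hfv : ∀ᵐ x ∂volume.restrict (Ioo 0 ℓ), f x * v x = f x * y' x - f' x * y x := by
    filter_upwards [hvy, ae_restrict_mem measurableSet_Ioo] with x hx hxℓ
    rw [hx]
    field_simp [hf.ne_zero x (Ioo_subset_Icc_self hxℓ)]
  refine ⟨fun x => f x * v x, by simp only [hf.normalized, one_mul, hv0],
    hf.solves.hasL2Deriv_wronskian hℓ hf' hy.solves hy' (hf'.mul hv) hfv,
    (hy'.mul (hf'.inv hf.ne_zero)).congr_deriv ?_⟩
  filter_upwards [hfv, ae_restrict_mem measurableSet_Ioo] with x hx hxℓ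
  rw [hx]
  field_simp [hf.ne_zero x (Ioo_subset_Icc_self hxℓ)]
  ring

/- With `z = y / f` and `W = f y' - f' y` the equation reads `z' = W / f²`, `W' = -ρ² f² z`, whose
coefficients are continuous although `f'` is only square integrable. -/
lemma IsExpSolution.eqOn (hℓ : 0 ≤ ℓ) (hf : IsNonvanishingSolution ℓ σ f) {y₁ y₂ : ℝ → ℂ}
    (h₁ : IsExpSolution ℓ σ f ρ y₁) (h₂ : IsExpSolution ℓ σ f ρ y₂) : EqOn y₁ y₂ (Icc 0 ℓ) := by
  obtain ⟨f', hf', -⟩ := hf.solves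
  obtain ⟨W₁, hW₁0, hW₁, hz₁⟩ := h₁.exists_wronskian hℓ hf
  obtain ⟨W₂, hW₂0, hW₂, hz₂⟩ := h₂.exists_wronskian hℓ hf
  have hzero := eqOn_zero_of_hasL2Deriv_mul (b := fun x => -ρ ^ 2 * f x ^ 2)
    ((hf'.continuousOn.pow 2).inv₀ fun x hx => pow_ne_zero 2 (hf.ne_zero x hx))
    (continuousOn_const.mul (hf'.continuousOn.pow 2))
    ((hz₁.sub hz₂).congr_deriv (Eventually.of_forall fun x => (mul_sub _ _ _).symm))
    ((hW₁.sub hW₂).congr_deriv ?_) (by simp [h₁.init, h₂.init]) (by simp [hW₁0, hW₂0])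
  · intro x hx
    have := hzero hx
    simpa [sub_eq_zero, hf.ne_zero x hx, ← sub_mul] using this
  · filter_upwards [ae_restrict_mem measurableSet_Ioo] with x hx
    field_simp [hf.ne_zero x (Ioo_subset_Icc_self hx)]
    ring

end Wronskian

lemma mul_le_div_mul_sq_add_div_mul_sq {c d : ℝ} (hc : 0 < c) (hd : 0 < d) (a b : ℝ) :
    a * b ≤ c / (2 * d) * a ^ 2 + d / (2 * c) * b ^ 2 := by
  have hsq : c / (2 * d) * a ^ 2 + d / (2 * c) * b ^ 2 - a * b =
      (c * a - d * b) ^ 2 / (2 * d * c) := by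
    field_simp; ring
  rw [← sub_nonneg, hsq]
  positivity

lemma exists_forall_integral_Iic_norm_mul_exp_le {E : Type*} [NormedAddCommGroup E] {k : ℝ → E}
    (hk : MemLp k 2) : ∃ lam : ℝ, 0 ≤ lam ∧ ∀ x,
      IntegrableOn (fun s => ‖k s‖ * Real.exp (lam * s)) (Iic x) ∧
      ∫ s in Iic x, ‖k s‖ * Real.exp (lam * s) ≤ 1 / 2 * Real.exp (lam * x) := by
  set J := ∫ s, ‖k s‖ ^ 2
  have hJ : 0 ≤ J := integral_nonneg fun s => sq_nonneg _
  obtain ⟨lam, hlam⟩ : ∃ lam, lam = 2 * (J + 1) := ⟨_, rfl⟩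
  have hlam0 : 0 < lam := hlam ▸ mul_pos two_pos (add_pos_of_nonneg_of_pos hJ one_pos)
  refine ⟨lam, hlam0.le, fun x => ?_⟩
  set X := Real.exp (lam * x)
  have hX : 0 < X := Real.exp_pos _
  have hexp : ∀ s, Real.exp (2 * lam * s) = Real.exp (lam * s) ^ 2 := fun s => by
    rw [← Real.exp_nat_mul]; push_cast; ring_nf
  have hamgm : ∀ s, ‖k s‖ * Real.exp (lam * s) ≤
      X / (2 * lam) * ‖k s‖ ^ 2 + lam / (2 * X) * Real.exp (2 * lam * s) := fun s =>
    hexp s ▸ mul_le_div_mul_sq_add_div_mul_sq hX hlam0 _ _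
  have hint₁ : Integrable (fun s => X / (2 * lam) * ‖k s‖ ^ 2) := hk.norm.integrable_sq.const_mul _
  have hint₂ : IntegrableOn (fun s => lam / (2 * X) * Real.exp (2 * lam * s)) (Iic x) :=
    (integrableOn_exp_mul_Iic (by positivity) x).const_mul _
  have hint : IntegrableOn (fun s => ‖k s‖ * Real.exp (lam * s)) (Iic x) := by
    refine Integrable.mono' (hint₁.restrict.add hint₂)
      (hk.1.norm.mul (by fun_prop)).restrict (Eventually.of_forall fun s => ?_)
    rw [Real.norm_of_nonneg (by positivity)]
    exact hamgm s
  refine ⟨hint, ?_⟩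
  calc ∫ s in Iic x, ‖k s‖ * Real.exp (lam * s)
      ≤ ∫ s in Iic x, (X / (2 * lam) * ‖k s‖ ^ 2 + lam / (2 * X) * Real.exp (2 * lam * s)) :=
        integral_mono hint (hint₁.restrict.add hint₂) hamgm
    _ ≤ X / (2 * lam) * J + lam / (2 * X) * (X ^ 2 / (2 * lam)) := by
        rw [integral_add hint₁.restrict hint₂, integral_const_mul, integral_const_mul,
          integral_exp_mul_Iic (by positivity), hexp]
        gcongr
        exact setIntegral_le_integral hk.norm.integrable_sq
          (Eventually.of_forall fun s => sq_nonneg _)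
    _ ≤ 1 / 2 * X := by
        rw [← sub_nonneg]
        have : 1 / 2 * X - (X / (2 * lam) * J + lam / (2 * X) * (X ^ 2 / (2 * lam))) =
            X / (2 * lam) := by
          field_simp; rw [hlam]; ring
        rw [this]
        positivity

/-- The integral operator `φ ↦ ∫_0^x h(s) φ(s, 2s - t) ds` of the equation of the kernel. The
integral is over `Ioc 0 x`, so that it vanishes for `x < 0`. -/
noncomputable def volterraOp (h : ℝ → ℂ) (φ : ℝ → ℝ → ℂ) (x t : ℝ) : ℂ :=
  ∫ s in Ioc 0 x, h s * φ s (2 * s - t)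

/-- The inhomogeneous term of the equation of the kernel: `h(t/2)/2` on `0 ≤ t ≤ 2x`, extended by
zero. -/
noncomputable def volterraSource (h : ℝ → ℂ) (x : ℝ) : ℝ → ℂ :=
  indicator (Icc 0 (2 * x)) fun t => h (t / 2) / 2

/-- The `n`-th term of the Neumann series of the equation of the kernel. -/
noncomputable def volterraIter (h : ℝ → ℂ) (n : ℕ) : ℝ → ℝ → ℂ :=
  (volterraOp h)^[n] (volterraSource h)

/-- The solution `S` of `S(x,t) = h(t/2)/2 + ∫_0^x h(s) S(s, 2s - t) ds` on `0 ≤ t ≤ 2x`, extended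
by zero, as the sum of its Neumann series. -/
noncomputable def volterraKernel (h : ℝ → ℂ) (x t : ℝ) : ℂ := ∑' n, volterraIter h n x t

section Volterra

variable {h : ℝ → ℂ} {φ : ℝ → ℝ → ℂ} {x t : ℝ}

lemma volterraIter_succ (n : ℕ) : volterraIter h (n + 1) = volterraOp h (volterraIter h n) :=
  Function.iterate_succ_apply' _ _ _

lemma measurable_volterraOp (hh : Measurable h) (hφ : Measurable (Function.uncurry φ)) :
    Measurable (Function.uncurry (volterraOp h φ)) := by
  have hop : Function.uncurry (volterraOp h φ) = fun p : ℝ × ℝ =>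
      ∫ s, indicator {q : (ℝ × ℝ) × ℝ | q.2 ∈ Ioc 0 q.1.1}
        (fun q => h q.2 * Function.uncurry φ (q.2, 2 * q.2 - q.1.2)) (p, s) := by
    ext p
    simp only [Function.uncurry_def, volterraOp, ← integral_indicator measurableSet_Ioc]
    rfl
  rw [hop]
  refine (Measurable.stronglyMeasurable ?_).integral_prod_right'.measurable
  exact ((hh.comp measurable_snd).mul (hφ.comp (by fun_prop))).indicator
    ((measurableSet_lt measurable_const measurable_snd).inter
      (measurableSet_le measurable_snd measurable_fst.fst))

lemma measurable_volterraSource (hh : Measurable h) :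
    Measurable (Function.uncurry (volterraSource h)) :=
  Measurable.indicator (f := fun p : ℝ × ℝ => h (p.2 / 2) / 2) (s := {p | p.2 ∈ Icc 0 (2 * p.1)})
    ((hh.comp (measurable_snd.div_const 2)).div_const 2)
    ((measurableSet_le measurable_const measurable_snd).inter
      (measurableSet_le measurable_snd (measurable_fst.const_mul 2)))

lemma measurable_volterraIter (hh : Measurable h) (n : ℕ) :
    Measurable (Function.uncurry (volterraIter h n)) := by
  induction n with
  | zero => exact measurable_volterraSource hh
  | succ n ih => exact volterraIter_succ (h := h) n ▸ measurable_volterraOp hh ih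

lemma volterraOp_eq_zero_of_notMem (hφ : ∀ x, ∀ t ∉ Icc 0 (2 * x), φ x t = 0)
    (ht : t ∉ Icc 0 (2 * x)) : volterraOp h φ x t = 0 := by
  refine setIntegral_eq_zero_of_forall_eq_zero fun s hs => ?_
  rw [hφ s _ fun hst => ht ⟨by linarith [hst.2], by linarith [hst.1, hs.2]⟩, mul_zero]

lemma volterraIter_eq_zero_of_notMem (n : ℕ) :
    ∀ x, ∀ t ∉ Icc 0 (2 * x), volterraIter h n x t = 0 := by
  induction n with
  | zero => exact fun x t ht => (indicator_of_notMem ht _ : volterraSource h x t = 0)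
  | succ n ih => exact fun x t ht => volterraIter_succ (h := h) n ▸
      volterraOp_eq_zero_of_notMem ih ht

lemma volterraKernel_eq_zero_of_notMem (ht : t ∉ Icc 0 (2 * x)) : volterraKernel h x t = 0 := by
  simp only [volterraKernel, volterraIter_eq_zero_of_notMem _ x t ht, tsum_zero]

lemma norm_volterraSource_le (x t : ℝ) : ‖volterraSource h x t‖ ≤ ‖h (t / 2)‖ := by
  refine (norm_indicator_le_norm_self _ _).trans ?_
  rw [norm_div, Complex.norm_two]
  exact half_le_self (norm_nonneg _)

lemma aestronglyMeasurable_mul_volterraIter (hh : Measurable h) (n : ℕ) (x t : ℝ) :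
    AEStronglyMeasurable (fun s => h s * volterraIter h n s (2 * s - t))
      (volume.restrict (Ioc 0 x)) :=
  (hh.mul ((measurable_volterraIter hh n).comp
    (measurable_id.prodMk (by fun_prop : Measurable fun s : ℝ => 2 * s - t)))).aestronglyMeasurable

lemma integral_norm_mul_volterraSource_le (hh : Measurable h) (hL : MemLp h 2) (x t : ℝ) :
    IntegrableOn (fun s => h s * volterraSource h s (2 * s - t)) (Ioc 0 x) ∧
      ∫ s in Ioc 0 x, ‖h s * volterraSource h s (2 * s - t)‖ ≤ ∫ s, ‖h s‖ ^ 2 := by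
  have hsq : Integrable (fun s => ‖h s‖ ^ 2) := hL.norm.integrable_sq
  have hsq_sub : Integrable (fun s => ‖h (s - t / 2)‖ ^ 2) := hsq.comp_sub_right (t / 2)
  have hmaj : Integrable (fun s => (‖h s‖ ^ 2 + ‖h (s - t / 2)‖ ^ 2) / 2) :=
    (hsq.add hsq_sub).div_const 2
  have hle : ∀ s, ‖h s * volterraSource h s (2 * s - t)‖ ≤
      (‖h s‖ ^ 2 + ‖h (s - t / 2)‖ ^ 2) / 2 := fun s => by
    have hsource := norm_volterraSource_le (h := h) s (2 * s - t)
    rw [show (2 * s - t) / 2 = s - t / 2 by ring] at hsource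
    rw [norm_mul]
    nlinarith [two_mul_le_add_sq ‖h s‖ ‖h (s - t / 2)‖, norm_nonneg (h s)]
  have hint : IntegrableOn (fun s => h s * volterraSource h s (2 * s - t)) (Ioc 0 x) :=
    hmaj.integrableOn.mono' (aestronglyMeasurable_mul_volterraIter hh 0 x t)
      (Eventually.of_forall hle)
  refine ⟨hint, ?_⟩
  calc ∫ s in Ioc 0 x, ‖h s * volterraSource h s (2 * s - t)‖
      ≤ ∫ s in Ioc 0 x, (‖h s‖ ^ 2 + ‖h (s - t / 2)‖ ^ 2) / 2 :=
        integral_mono hint.norm hmaj.integrableOn hle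
    _ ≤ ∫ s, (‖h s‖ ^ 2 + ‖h (s - t / 2)‖ ^ 2) / 2 :=
        setIntegral_le_integral hmaj (Eventually.of_forall fun s => by positivity)
    _ = ∫ s, ‖h s‖ ^ 2 := by
        rw [integral_div, integral_add hsq hsq_sub,
          integral_sub_right_eq_self (fun s => ‖h s‖ ^ 2)]
        ring

lemma integral_norm_mul_le_of_norm_le_mul_exp {ψ : ℝ → ℂ} {M r lam : ℝ} (hM : 0 ≤ M)
    (hmeas : AEStronglyMeasurable (fun s => h s * ψ s) (volume.restrict (Ioc 0 x)))
    (hψ : ∀ s, ‖ψ s‖ ≤ M * Real.exp (lam * s))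
    (hint : IntegrableOn (fun s => ‖h s‖ * Real.exp (lam * s)) (Iic x))
    (hr : ∫ s in Iic x, ‖h s‖ * Real.exp (lam * s) ≤ r) :
    IntegrableOn (fun s => h s * ψ s) (Ioc 0 x) ∧ ∫ s in Ioc 0 x, ‖h s * ψ s‖ ≤ M * r := by
  have hle : ∀ s, ‖h s * ψ s‖ ≤ M * (‖h s‖ * Real.exp (lam * s)) := fun s => by
    rw [norm_mul, mul_left_comm]
    gcongr
    exact hψ s
  have hmaj : IntegrableOn (fun s => M * (‖h s‖ * Real.exp (lam * s))) (Iic x) := hint.const_mul _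
  have hmaj_Ioc := hmaj.mono_set (Ioc_subset_Iic_self (a := 0))
  have hint_mul := hmaj_Ioc.mono' hmeas (Eventually.of_forall hle)
  refine ⟨hint_mul, ?_⟩
  calc ∫ s in Ioc 0 x, ‖h s * ψ s‖
      ≤ ∫ s in Ioc 0 x, M * (‖h s‖ * Real.exp (lam * s)) :=
        integral_mono hint_mul.norm hmaj_Ioc hle
    _ ≤ ∫ s in Iic x, M * (‖h s‖ * Real.exp (lam * s)) :=
        setIntegral_mono_set hmaj (Eventually.of_forall fun s => by positivity)
          Ioc_subset_Iic_self.eventuallyLE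
    _ ≤ M * r := by
        rw [integral_const_mul]
        gcongr

/- In the norm weighted by `e^{lam x}` with `lam` large, `volterraOp h` contracts by `1/2`. -/
lemma exists_integral_norm_mul_volterraIter_le (hh : Measurable h) (hL : MemLp h 2) :
    ∃ lam : ℝ, 0 ≤ lam ∧ ∀ n x t,
      IntegrableOn (fun s => h s * volterraIter h n s (2 * s - t)) (Ioc 0 x) ∧
      ∫ s in Ioc 0 x, ‖h s * volterraIter h n s (2 * s - t)‖ ≤
        (∫ s, ‖h s‖ ^ 2) * (1 / 2) ^ n * Real.exp (lam * x) := by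
  obtain ⟨lam, hlam, hweight⟩ := exists_forall_integral_Iic_norm_mul_exp_le hL
  set J := ∫ s, ‖h s‖ ^ 2
  have hJ : 0 ≤ J := integral_nonneg fun s => sq_nonneg _
  refine ⟨lam, hlam, fun n => ?_⟩
  induction n with
  | zero =>
    intro x t
    obtain ⟨hint, hle⟩ := integral_norm_mul_volterraSource_le hh hL x t
    refine ⟨hint, ?_⟩
    rcases lt_or_ge x 0 with hx | hx
    · rw [Ioc_eq_empty (by linarith), setIntegral_empty]
      positivity
    · rw [pow_zero, mul_one]
      exact hle.trans (le_mul_of_one_le_right hJ (Real.one_le_exp (mul_nonneg hlam hx)))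
  | succ n ih =>
    intro x t
    have hiter : ∀ s τ, ‖volterraIter h (n + 1) s τ‖ ≤ J * (1 / 2) ^ n * Real.exp (lam * s) :=
      fun s τ => volterraIter_succ (h := h) n ▸
        (norm_integral_le_integral_norm _).trans (ih s τ).2
    rw [pow_succ, ← mul_assoc, mul_assoc _ (1 / 2 : ℝ)]
    exact integral_norm_mul_le_of_norm_le_mul_exp (by positivity)
      (aestronglyMeasurable_mul_volterraIter hh (n + 1) x t) (fun s => hiter s _)
      (hweight x).1 (hweight x).2

lemma exists_norm_volterraIter_succ_le (hh : Measurable h) (hL : MemLp h 2) (ℓ : ℝ) :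
    ∃ D : ℝ, 0 ≤ D ∧ ∀ n, ∀ x ≤ ℓ, ∀ t, ‖volterraIter h (n + 1) x t‖ ≤ D * (1 / 2) ^ n := by
  obtain ⟨lam, hlam, hiter⟩ := exists_integral_norm_mul_volterraIter_le hh hL
  refine ⟨(∫ s, ‖h s‖ ^ 2) * Real.exp (lam * ℓ), by positivity, fun n x hx t => ?_⟩
  rw [volterraIter_succ, mul_right_comm]
  refine (norm_integral_le_integral_norm _).trans ((hiter n x t).2.trans ?_)
  gcongr

lemma summable_volterraIter (hh : Measurable h) (hL : MemLp h 2) (x t : ℝ) :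
    Summable fun n => volterraIter h n x t := by
  obtain ⟨D, -, hD⟩ := exists_norm_volterraIter_succ_le hh hL x
  exact (summable_nat_add_iff 1).1 (Summable.of_norm_bounded (summable_geometric_two.mul_left D)
    fun n => hD n x le_rfl t)

lemma measurable_volterraKernel (hh : Measurable h) (hL : MemLp h 2) :
    Measurable (Function.uncurry (volterraKernel h)) := by
  refine measurable_of_tendsto_metrizable
    (f := fun N p => ∑ n ∈ Finset.range N, Function.uncurry (volterraIter h n) p)
    (fun N => Finset.measurable_fun_sum _ fun n _ => measurable_volterraIter hh n) ?_
  rw [tendsto_pi_nhds]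
  exact fun p => (summable_volterraIter hh hL p.1 p.2).hasSum.tendsto_sum_nat

lemma volterraOp_volterraKernel (hh : Measurable h) (hL : MemLp h 2) (x t : ℝ) :
    volterraOp h (volterraKernel h) x t = ∑' n, volterraIter h (n + 1) x t := by
  obtain ⟨lam, -, hiter⟩ := exists_integral_norm_mul_volterraIter_le hh hL
  have hsum : Summable fun n => ∫ s in Ioc 0 x, ‖h s * volterraIter h n s (2 * s - t)‖ := by
    refine Summable.of_nonneg_of_le (fun n => integral_nonneg fun s => norm_nonneg _)
      (fun n => (hiter n x t).2) ?_
    exact (summable_geometric_two.mul_left _).mul_right _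
  simp only [volterraIter_succ, volterraOp, volterraKernel, ← tsum_mul_left]
  exact (integral_tsum_of_summable_integral_norm (fun n => (hiter n x t).1) hsum).symm

lemma volterraKernel_eq (hh : Measurable h) (hL : MemLp h 2) (x t : ℝ) :
    volterraKernel h x t = volterraSource h x t + volterraOp h (volterraKernel h) x t := by
  rw [volterraOp_volterraKernel hh hL, volterraKernel,
    (summable_volterraIter hh hL x t).tsum_eq_zero_add]
  rfl

end Volterra

section Transform

variable {h : ℝ → ℂ} {ρ : ℂ} {x : ℝ}

lemma exists_norm_volterraKernel_le (hh : Measurable h) (hL : MemLp h 2) (ℓ : ℝ) :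
    ∃ g : ℝ → ℝ, Integrable g ∧ MemLp g 2 ∧ ∀ x ≤ ℓ, ∀ t, ‖volterraKernel h x t‖ ≤ g t := by
  obtain ⟨D, hD0, hD⟩ := exists_norm_volterraIter_succ_le hh hL ℓ
  have hdiv : MemLp (fun t => h (t / 2)) 2 :=
    (memLp_two_iff_integrable_sq_norm
      (hh.comp (measurable_id.div_const 2)).aestronglyMeasurable).2
      (hL.norm.integrable_sq.comp_div two_ne_zero)
  have hg : MemLp (fun t => ‖h (t / 2)‖ + D * 2) 2 (volume.restrict (Icc 0 (2 * ℓ))) :=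
    hdiv.norm.restrict _ |>.add (memLp_const _)
  refine ⟨indicator (Icc 0 (2 * ℓ)) fun t => ‖h (t / 2)‖ + D * 2,
    (integrable_indicator_iff measurableSet_Icc).2 (hg.integrable one_le_two),
    (memLp_indicator_iff_restrict measurableSet_Icc).2 hg, fun x hx t => ?_⟩
  by_cases ht : t ∈ Icc 0 (2 * x)
  · rw [indicator_of_mem (Icc_subset_Icc_right (by linarith) ht), volterraKernel_eq hh hL,
      volterraOp_volterraKernel hh hL]
    exact (norm_add_le _ _).trans (add_le_add (norm_volterraSource_le x t)
      (tsum_of_norm_bounded (hasSum_geometric_two.mul_left D) fun n => hD n x hx t))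
  · rw [volterraKernel_eq_zero_of_notMem ht, norm_zero]
    exact indicator_nonneg (fun t _ => by positivity) t

lemma norm_exp_I_mul_le (ρ : ℂ) {t T : ℝ} (ht : |t| ≤ T) :
    ‖Complex.exp (Complex.I * ρ * t)‖ ≤ Real.exp (‖ρ‖ * T) := by
  refine (Complex.norm_exp_le_exp_norm _).trans (Real.exp_le_exp.2 ?_)
  rw [norm_mul, norm_mul, Complex.norm_I, one_mul, Complex.norm_real, Real.norm_eq_abs]
  gcongr

lemma exists_norm_volterraKernel_mul_exp_le (hh : Measurable h) (hL : MemLp h 2) (ρ : ℂ) (ℓ : ℝ) :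
    ∃ g : ℝ → ℝ, Integrable g ∧ ∀ x ≤ ℓ, ∀ t : ℝ,
      ‖volterraKernel h x t * Complex.exp (Complex.I * ρ * t)‖ ≤ g t := by
  obtain ⟨g, hg, -, hle⟩ := exists_norm_volterraKernel_le hh hL ℓ
  refine ⟨fun t => g t * Real.exp (‖ρ‖ * (2 * ℓ)), hg.mul_const _, fun x hx t => ?_⟩
  have hgt : 0 ≤ g t := (norm_nonneg _).trans (hle x hx t)
  by_cases ht : t ∈ Icc 0 (2 * x)
  · rw [norm_mul]
    exact mul_le_mul (hle x hx t)
      (norm_exp_I_mul_le ρ (by rw [abs_of_nonneg ht.1]; linarith [ht.2])) (norm_nonneg _) hgt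
  · rw [volterraKernel_eq_zero_of_notMem ht, zero_mul, norm_zero]
    positivity

lemma measurable_volterraKernel_mul_exp (hh : Measurable h) (hL : MemLp h 2) (ρ : ℂ) :
    Measurable fun p : ℝ × ℝ => volterraKernel h p.1 p.2 * Complex.exp (Complex.I * ρ * p.2) :=
  (measurable_volterraKernel hh hL).mul (by fun_prop)

lemma integrable_volterraKernel_mul_exp (hh : Measurable h) (hL : MemLp h 2) (ρ : ℂ) (x : ℝ) :
    Integrable fun t : ℝ => volterraKernel h x t * Complex.exp (Complex.I * ρ * t) := by
  obtain ⟨g, hg, hle⟩ := exists_norm_volterraKernel_mul_exp_le hh hL ρ x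
  exact hg.mono' ((measurable_volterraKernel_mul_exp hh hL ρ).comp
    measurable_prodMk_left).aestronglyMeasurable (Eventually.of_forall (hle x le_rfl))

lemma integrable_prod_comp_two_mul_sub {g : ℝ → ℂ} {φ : ℝ → ℝ → ℂ} {μ : Measure ℝ} [SFinite μ]
    (hint : Integrable (fun p : ℝ × ℝ => g p.1 * φ p.1 p.2) (μ.prod volume)) :
    Integrable (fun p : ℝ × ℝ => g p.1 * φ p.1 (2 * p.1 - p.2)) (μ.prod volume) := by
  have hshear : MeasurePreserving (fun p : ℝ × ℝ => (p.1, 2 * p.1 - p.2)) (μ.prod volume)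
      (μ.prod volume) :=
    (MeasurePreserving.id μ).skew_product (g := fun s t => 2 * s - t)
      (by fun_prop : Measurable fun p : ℝ × ℝ => 2 * p.1 - p.2)
      (Eventually.of_forall fun s => (Measure.measurePreserving_sub_left volume (2 * s)).map_eq)
  exact hshear.integrable_comp_of_integrable hint

lemma integrable_volterraOp {g : ℝ → ℂ} {φ : ℝ → ℝ → ℂ}
    (hint : Integrable (fun p : ℝ × ℝ => g p.1 * φ p.1 p.2)
      ((volume.restrict (Ioc 0 x)).prod volume)) : Integrable (volterraOp g φ x) :=
  (integrable_prod_comp_two_mul_sub hint).integral_prod_right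

lemma integral_volterraOp {g : ℝ → ℂ} {φ : ℝ → ℝ → ℂ}
    (hint : Integrable (fun p : ℝ × ℝ => g p.1 * φ p.1 p.2)
      ((volume.restrict (Ioc 0 x)).prod volume)) :
    ∫ t, volterraOp g φ x t = ∫ s in Ioc 0 x, g s * ∫ t, φ s t := by
  simp only [volterraOp]
  rw [← integral_integral_swap (integrable_prod_comp_two_mul_sub hint)]
  refine integral_congr_ae (Eventually.of_forall fun s => ?_)
  exact (integral_const_mul _ _).trans
    (congrArg _ (integral_sub_left_eq_self (φ s) volume (2 * s)))

/-- The Fourier type transform `1 + ∫ S(x,t) e^{iρt} dt` of the kernel. -/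
noncomputable def kernelTransform (h : ℝ → ℂ) (ρ : ℂ) (x : ℝ) : ℂ :=
  1 + ∫ t : ℝ, volterraKernel h x t * Complex.exp (Complex.I * ρ * t)

lemma volterraOp_volterraKernel_mul_exp (x t : ℝ) :
    volterraOp h (volterraKernel h) x t * Complex.exp (Complex.I * ρ * t) =
      volterraOp (fun s => h s * Complex.exp (2 * Complex.I * ρ * s))
        (fun s t => volterraKernel h s t * Complex.exp (Complex.I * -ρ * t)) x t := by
  rw [volterraOp, volterraOp, ← integral_mul_const]
  refine integral_congr_ae (Eventually.of_forall fun s => ?_)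
  have hexp : Complex.exp (Complex.I * ρ * t) = Complex.exp (2 * Complex.I * ρ * s) *
      Complex.exp (Complex.I * -ρ * ((2 * s - t : ℝ) : ℂ)) := by
    rw [← Complex.exp_add]; push_cast; ring_nf
  simp only [hexp]
  ring

lemma integral_volterraSource_mul_exp (hx : 0 ≤ x) :
    ∫ t : ℝ, volterraSource h x t * Complex.exp (Complex.I * ρ * t) =
      ∫ s in (0 : ℝ)..x, h s * Complex.exp (2 * Complex.I * ρ * s) := by
  have hsource : (fun t : ℝ => volterraSource h x t * Complex.exp (Complex.I * ρ * t)) =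
      indicator (Icc 0 (2 * x)) fun t : ℝ =>
        h (t / 2) * Complex.exp (2 * Complex.I * ρ * ((t / 2 : ℝ) : ℂ)) / 2 := by
    ext t
    by_cases ht : t ∈ Icc 0 (2 * x)
    · rw [volterraSource, indicator_of_mem ht, indicator_of_mem ht]
      push_cast
      ring_nf
    · rw [volterraSource, indicator_of_notMem ht, indicator_of_notMem ht, zero_mul]
  rw [hsource, integral_indicator measurableSet_Icc, integral_Icc_eq_integral_Ioc,
    ← intervalIntegral.integral_of_le (by positivity), intervalIntegral.integral_div,
    intervalIntegral.integral_comp_div (fun s : ℝ => h s * Complex.exp (2 * Complex.I * ρ * s))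
      two_ne_zero, zero_div, mul_div_cancel_left₀ _ two_ne_zero, Complex.real_smul]
  push_cast
  ring

lemma memLp_mul_exp (hL : MemLp h 2) (ρ : ℂ) (x : ℝ) :
    MemLp (fun s : ℝ => h s * Complex.exp (2 * Complex.I * ρ * s)) 2
      (volume.restrict (Ioo 0 x)) := by
  simp only [mul_comm (h _)]
  exact memLp_Ioo_continuousOn_mul (by fun_prop) (hL.restrict _)

lemma integrableOn_mul_exp (hL : MemLp h 2) (ρ : ℂ) (x : ℝ) :
    IntegrableOn (fun s : ℝ => h s * Complex.exp (2 * Complex.I * ρ * s)) (Ioc 0 x) := by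
  rw [integrableOn_Ioc_iff_integrableOn_Ioo]
  exact (memLp_mul_exp hL ρ x).integrable one_le_two

lemma integrable_mul_volterraKernel_mul_exp (hh : Measurable h) (hL : MemLp h 2) (ρ : ℂ) (x : ℝ) :
    Integrable (fun p : ℝ × ℝ => h p.1 * Complex.exp (2 * Complex.I * ρ * p.1) *
      (volterraKernel h p.1 p.2 * Complex.exp (Complex.I * -ρ * p.2)))
      ((volume.restrict (Ioc 0 x)).prod volume) := by
  obtain ⟨g, hg, hle⟩ := exists_norm_volterraKernel_mul_exp_le hh hL (-ρ) x
  refine ((integrableOn_mul_exp hL ρ x).norm.mul_prod hg).mono'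
    (((hh.comp measurable_fst).mul (by fun_prop)).mul
      (measurable_volterraKernel_mul_exp hh hL (-ρ))).aestronglyMeasurable ?_
  filter_upwards [Measure.quasiMeasurePreserving_fst.ae
    (ae_restrict_mem (μ := volume) (measurableSet_Ioc (a := 0) (b := x)))] with p hp
  rw [norm_mul]
  gcongr
  exact hle _ hp.2 _

lemma integrableOn_mul_kernelTransform (hh : Measurable h) (hL : MemLp h 2) (ρ : ℂ) (x : ℝ) :
    IntegrableOn (fun s : ℝ => h s * Complex.exp (2 * Complex.I * ρ * s) *
      kernelTransform h (-ρ) s) (Ioc 0 x) := by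
  have hint := (integrable_mul_volterraKernel_mul_exp hh hL ρ x).integral_prod_left
  simp only [integral_const_mul] at hint
  simp only [kernelTransform, mul_add, mul_one]
  exact (integrableOn_mul_exp hL ρ x).add hint

lemma kernelTransform_eq (hh : Measurable h) (hL : MemLp h 2) (ρ : ℂ) (hx : 0 ≤ x) :
    kernelTransform h ρ x = 1 + ∫ s in Ioc 0 x, h s * Complex.exp (2 * Complex.I * ρ * s) *
      kernelTransform h (-ρ) s := by
  have hprod := integrable_mul_volterraKernel_mul_exp hh hL ρ x
  have hop := integrable_volterraOp
    (g := fun s : ℝ => h s * Complex.exp (2 * Complex.I * ρ * s))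
    (φ := fun s t => volterraKernel h s t * Complex.exp (Complex.I * -ρ * t)) hprod
  have hsource := integral_volterraSource_mul_exp (h := h) (ρ := ρ) hx
  have hsource_eq : ∀ t : ℝ, volterraSource h x t * Complex.exp (Complex.I * ρ * t) =
      volterraKernel h x t * Complex.exp (Complex.I * ρ * t) -
        volterraOp (fun s => h s * Complex.exp (2 * Complex.I * ρ * s))
          (fun s t => volterraKernel h s t * Complex.exp (Complex.I * -ρ * t)) x t := fun t => by
    rw [← volterraOp_volterraKernel_mul_exp, volterraKernel_eq hh hL]
    ring
  simp only [hsource_eq] at hsource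
  rw [integral_sub (integrable_volterraKernel_mul_exp hh hL ρ x) hop,
    integral_volterraOp (g := fun s : ℝ => h s * Complex.exp (2 * Complex.I * ρ * s)) hprod,
    intervalIntegral.integral_of_le hx, sub_eq_iff_eq_add] at hsource
  have hint := hprod.integral_prod_left
  simp only [integral_const_mul] at hint
  rw [kernelTransform, hsource, ← integral_add (integrableOn_mul_exp hL ρ x) hint]
  simp only [kernelTransform, mul_add, mul_one]

lemma continuousOn_kernelTransform (hh : Measurable h) (hL : MemLp h 2) (ρ : ℂ) (ℓ : ℝ) :
    ContinuousOn (kernelTransform h ρ) (Icc 0 ℓ) := by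
  refine ContinuousOn.congr (continuousOn_const.add (intervalIntegral.continuousOn_primitive
    ?_)) fun x hx => kernelTransform_eq hh hL ρ hx.1
  rw [integrableOn_Icc_iff_integrableOn_Ioc]
  exact integrableOn_mul_kernelTransform hh hL ρ ℓ

lemma hasL2Deriv_kernelTransform (hh : Measurable h) (hL : MemLp h 2) (ρ : ℂ) (ℓ : ℝ) :
    HasL2Deriv ℓ (kernelTransform h ρ) fun s =>
      h s * Complex.exp (2 * Complex.I * ρ * s) * kernelTransform h (-ρ) s := by
  constructor
  · simp only [mul_comm _ (kernelTransform h (-ρ) _)]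
    exact memLp_Ioo_continuousOn_mul (continuousOn_kernelTransform hh hL (-ρ) ℓ)
      (memLp_mul_exp hL ρ ℓ)
  · intro x hx
    rw [kernelTransform_eq hh hL ρ hx.1, kernelTransform_eq hh hL ρ le_rfl, Ioc_self,
      setIntegral_empty, add_zero, intervalIntegral.integral_of_le hx.1]

/-- The solution `J_ρ(x) = e^{-iρx} (1 + ∫ S(x,t) e^{iρt} dt)` of the system
`J_ρ' = -iρ J_ρ + h J_{-ρ}`, `J_ρ(0) = 1`. -/
noncomputable def jostFunction (h : ℝ → ℂ) (ρ : ℂ) (x : ℝ) : ℂ :=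
  Complex.exp (-(Complex.I * ρ * x)) * kernelTransform h ρ x

lemma jostFunction_zero (hh : Measurable h) (hL : MemLp h 2) (ρ : ℂ) : jostFunction h ρ 0 = 1 := by
  simp [jostFunction, kernelTransform_eq hh hL ρ le_rfl]

lemma hasL2Deriv_exp (c : ℂ) (ℓ : ℝ) :
    HasL2Deriv ℓ (fun x : ℝ => Complex.exp (c * x)) fun x => c * Complex.exp (c * x) := by
  have hderiv : ∀ x : ℝ, deriv (fun x : ℝ => Complex.exp (c * x)) x = c * Complex.exp (c * x) :=
    fun x => by
      simpa [mul_comm] using ((Complex.ofRealCLM.hasDerivAt (x := x)).const_mul c).cexp.deriv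
  exact funext hderiv ▸ hasL2Deriv_of_contDiff
    (Complex.contDiff_exp.comp (contDiff_const.mul Complex.ofRealCLM.contDiff))

lemma hasL2Deriv_jostFunction (hh : Measurable h) (hL : MemLp h 2) (ρ : ℂ) (ℓ : ℝ) :
    HasL2Deriv ℓ (jostFunction h ρ) fun x =>
      -(Complex.I * ρ * jostFunction h ρ x) + h x * jostFunction h (-ρ) x := by
  have hexp := hasL2Deriv_exp (-(Complex.I * ρ)) ℓ
  simp only [neg_mul] at hexp
  refine (hexp.mul (hasL2Deriv_kernelTransform hh hL ρ ℓ)).congr_deriv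
    (Eventually.of_forall fun x => ?_)
  have hshift : Complex.exp (-(Complex.I * ρ * x)) * Complex.exp (2 * Complex.I * ρ * x) =
      Complex.exp (-(Complex.I * -ρ * x)) := by
    rw [← Complex.exp_add]; ring_nf
  simp only [jostFunction]
  linear_combination (h x * kernelTransform h (-ρ) x) * hshift

lemma volterraKernel_add_mul_exp (ρ : ℂ) (x t : ℝ) :
    volterraKernel h x (x + t) * Complex.exp (Complex.I * ρ * t) =
      Complex.exp (-(Complex.I * ρ * x)) *
        (volterraKernel h x (x + t) * Complex.exp (Complex.I * ρ * ((x + t : ℝ) : ℂ))) := by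
  rw [mul_left_comm, ← Complex.exp_add]
  push_cast
  ring_nf

lemma integrable_volterraKernel_add_mul_exp (hh : Measurable h) (hL : MemLp h 2) (ρ : ℂ) (x : ℝ) :
    Integrable fun t : ℝ => volterraKernel h x (x + t) * Complex.exp (Complex.I * ρ * t) := by
  simp only [volterraKernel_add_mul_exp]
  exact ((integrable_volterraKernel_mul_exp hh hL ρ x).comp_add_left x).const_mul _

lemma jostFunction_eq_integral (h : ℝ → ℂ) (ρ : ℂ) (x : ℝ) :
    jostFunction h ρ x = Complex.exp (-(Complex.I * ρ * x)) +
      ∫ t : ℝ, volterraKernel h x (x + t) * Complex.exp (Complex.I * ρ * t) := by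
  simp only [volterraKernel_add_mul_exp]
  rw [integral_const_mul, integral_add_left_eq_self (fun t : ℝ => volterraKernel h x t *
    Complex.exp (Complex.I * ρ * t)), jostFunction, kernelTransform, mul_add, mul_one]

lemma integrable_volterraKernel_sub_mul_exp (hh : Measurable h) (hL : MemLp h 2) (ρ : ℂ) (x : ℝ) :
    Integrable fun t : ℝ => volterraKernel h x (x - t) * Complex.exp (Complex.I * ρ * t) := by
  simpa [sub_eq_add_neg] using (integrable_volterraKernel_add_mul_exp hh hL (-ρ) x).comp_neg

lemma jostFunction_neg_eq_integral (h : ℝ → ℂ) (ρ : ℂ) (x : ℝ) :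
    jostFunction h (-ρ) x = Complex.exp (Complex.I * ρ * x) +
      ∫ t : ℝ, volterraKernel h x (x - t) * Complex.exp (Complex.I * ρ * t) := by
  rw [jostFunction_eq_integral, ← integral_neg_eq_self]
  simp [sub_eq_add_neg]

end Transform

lemma exists_measurable_memLp_ae_eq {α E : Type*} [MeasurableSpace α] [NormedAddCommGroup E]
    [MeasurableSpace E] [BorelSpace E] {μ : Measure α} {s : Set α} {p : ENNReal} {g : α → E}
    (hs : MeasurableSet s) (hg : MemLp g p (μ.restrict s)) :
    ∃ h, Measurable h ∧ MemLp h p μ ∧ h =ᵐ[μ.restrict s] g := by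
  refine ⟨indicator s (hg.1.mk g), hg.1.stronglyMeasurable_mk.measurable.indicator hs,
    (memLp_indicator_iff_restrict hs).2 (hg.ae_eq hg.1.ae_eq_mk), ?_⟩
  filter_upwards [hg.1.ae_eq_mk, ae_restrict_mem hs] with x hx hxs
  rw [indicator_of_mem hxs, hx]

lemma memLp_prod_of_eLpNorm_le {α β E : Type*} [MeasurableSpace α] [MeasurableSpace β]
    [NormedAddCommGroup E] {μ : Measure α} {ν : Measure β} [IsFiniteMeasure μ] [SFinite ν]
    {p C : ENNReal} {F : α → β → E} (hp₀ : p ≠ 0) (hp : p ≠ ⊤) (hC : C ≠ ⊤)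
    (hF : AEStronglyMeasurable (Function.uncurry F) (μ.prod ν))
    (hle : ∀ᵐ x ∂μ, eLpNorm (F x) p ν ≤ C) : MemLp (Function.uncurry F) p (μ.prod ν) := by
  refine ⟨hF, ?_⟩
  rw [eLpNorm_lt_top_iff_lintegral_rpow_enorm_lt_top hp₀ hp,
    lintegral_prod _ (hF.enorm.pow_const _)]
  calc ∫⁻ x, ∫⁻ t, ‖F x t‖ₑ ^ p.toReal ∂ν ∂μ
      ≤ ∫⁻ _, C ^ p.toReal ∂μ := by
        refine lintegral_mono_ae ?_
        filter_upwards [hle] with x hx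
        rw [eLpNorm_eq_lintegral_rpow_enorm_toReal hp₀ hp, one_div] at hx
        exact (ENNReal.rpow_inv_le_iff (ENNReal.toReal_pos hp₀ hp)).1 hx
    _ < ⊤ := by
        rw [lintegral_const]
        exact ENNReal.mul_lt_top (ENNReal.rpow_lt_top_of_nonneg ENNReal.toReal_nonneg hC)
          (measure_lt_top _ _)

lemma eLpNorm_comp_add_comp_sub_le {G : Type*} {E : Type*} [NormedAddCommGroup E] {p : ENNReal}
    [MeasurableSpace G] [AddCommGroup G] [MeasurableAdd G] [MeasurableNeg G] {μ : Measure G}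
    [μ.IsAddLeftInvariant] [μ.IsNegInvariant] {g : G → E} (hp : 1 ≤ p)
    (hg : AEStronglyMeasurable g μ) (x : G) :
    eLpNorm (fun t => g (x + t) + g (x - t)) p μ ≤ eLpNorm g p μ + eLpNorm g p μ := by
  have hadd := measurePreserving_add_left μ x
  have hsub := Measure.measurePreserving_sub_left μ x
  refine (eLpNorm_add_le (hg.comp_measurePreserving hadd) (hg.comp_measurePreserving hsub)
    hp).trans_eq ?_
  rw [eLpNorm_comp_measurePreserving hg hadd, eLpNorm_comp_measurePreserving hg hsub]

/-- The transmutation kernel `K_f` for `h = f'/f`, in terms of the kernels `S` of `h` and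
of `-h`. It vanishes for `|t| > x`. -/
noncomputable def expKernel (h : ℝ → ℂ) (x t : ℝ) : ℂ :=
  1 / 2 * (volterraKernel h x (x + t) + volterraKernel h x (x - t) +
    volterraKernel (-h) x (x - t) - volterraKernel (-h) x (x + t))

/-- The solution `e_f(ρ, ·)` for `h = f'/f`. Writing `J̃` for the function `J` of `-h`, the pairs
`(J_{-ρ}, J_ρ)` and `(J̃_{-ρ}, -J̃_ρ)` solve the same system with the initial values `(1, 1)` and
`(1, -1)`; half their sum starts at `(1, 0)`, and `e_f(ρ, ·)` is the sum of its components. -/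
noncomputable def expSolution (h : ℝ → ℂ) (ρ : ℂ) (x : ℝ) : ℂ :=
  1 / 2 * (jostFunction h ρ x + jostFunction h (-ρ) x +
    jostFunction (-h) (-ρ) x - jostFunction (-h) ρ x)

/-- The quasi-derivative `D_f e_f(ρ, ·)` of `expSolution`: `iρ` times the difference of the
components. -/
noncomputable def expSolutionQuasi (h : ℝ → ℂ) (ρ : ℂ) (x : ℝ) : ℂ :=
  Complex.I * ρ * (1 / 2 * (jostFunction h (-ρ) x - jostFunction h ρ x +
    jostFunction (-h) (-ρ) x + jostFunction (-h) ρ x))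

section ExpKernel

variable {h : ℝ → ℂ} {ℓ x : ℝ}

lemma hasL2Deriv_expSolution (hh : Measurable h) (hL : MemLp h 2) (ρ : ℂ) (ℓ : ℝ) :
    HasL2Deriv ℓ (expSolution h ρ) fun x => h x * expSolution h ρ x + expSolutionQuasi h ρ x := by
  have hJ := hasL2Deriv_jostFunction hh hL ρ ℓ
  have hJneg := hasL2Deriv_jostFunction hh hL (-ρ) ℓ
  have hJ' := hasL2Deriv_jostFunction hh.neg hL.neg ρ ℓ
  have hJneg' := hasL2Deriv_jostFunction hh.neg hL.neg (-ρ) ℓ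
  rw [neg_neg] at hJneg hJneg'
  refine ((((hJ.add hJneg).add hJneg').sub hJ').const_mul (1 / 2)).congr_deriv
    (Eventually.of_forall fun x => ?_)
  simp only [expSolution, expSolutionQuasi, Pi.neg_apply]
  ring

lemma hasL2Deriv_expSolutionQuasi (hh : Measurable h) (hL : MemLp h 2) (ρ : ℂ) (ℓ : ℝ) :
    HasL2Deriv ℓ (expSolutionQuasi h ρ) fun x =>
      -(h x * expSolutionQuasi h ρ x) - ρ ^ 2 * expSolution h ρ x := by
  have hJ := hasL2Deriv_jostFunction hh hL ρ ℓ
  have hJneg := hasL2Deriv_jostFunction hh hL (-ρ) ℓ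
  have hJ' := hasL2Deriv_jostFunction hh.neg hL.neg ρ ℓ
  have hJneg' := hasL2Deriv_jostFunction hh.neg hL.neg (-ρ) ℓ
  rw [neg_neg] at hJneg hJneg'
  refine (((((hJneg.sub hJ).add hJneg').add hJ').const_mul (1 / 2)).const_mul
    (Complex.I * ρ)).congr_deriv (Eventually.of_forall fun x => ?_)
  simp only [expSolution, expSolutionQuasi, Pi.neg_apply]
  linear_combination (1 / 2 * ρ ^ 2 * (jostFunction h ρ x + jostFunction h (-ρ) x +
    jostFunction (-h) (-ρ) x - jostFunction (-h) ρ x)) * Complex.I_sq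

lemma isExpSolution_expSolution {σ f f' : ℝ → ℂ} (hℓ : 0 ≤ ℓ) (hf : IsNonvanishingSolution ℓ σ f)
    (hf' : HasL2Deriv ℓ f f') (hh : Measurable h) (hL : MemLp h 2)
    (hhf : h =ᵐ[volume.restrict (Ioo 0 ℓ)] fun x => f' x / f x) (ρ : ℂ) :
    IsExpSolution ℓ σ f ρ (expSolution h ρ) := by
  refine isExpSolution_of_hasL2Deriv hℓ hf hf' hhf (hasL2Deriv_expSolution hh hL ρ ℓ)
    (hasL2Deriv_expSolutionQuasi hh hL ρ ℓ) ?_ ?_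
  · simp only [expSolution, jostFunction_zero hh hL, jostFunction_zero hh.neg hL.neg]
    ring
  · simp only [expSolutionQuasi, jostFunction_zero hh hL, jostFunction_zero hh.neg hL.neg]
    ring

lemma expKernel_eq_zero_of_notMem {t : ℝ} (ht : t ∉ Icc (-x) x) : expKernel h x t = 0 := by
  have hadd : x + t ∉ Icc 0 (2 * x) := fun H => ht ⟨by linarith [H.1], by linarith [H.2]⟩
  have hsub : x - t ∉ Icc 0 (2 * x) := fun H => ht ⟨by linarith [H.2], by linarith [H.1]⟩
  simp only [expKernel, volterraKernel_eq_zero_of_notMem hadd,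
    volterraKernel_eq_zero_of_notMem hsub, add_zero, sub_zero, mul_zero]

lemma integral_expKernel_mul_exp (hh : Measurable h) (hL : MemLp h 2) (ρ : ℂ) (x : ℝ) :
    ∫ t : ℝ, expKernel h x t * Complex.exp (Complex.I * ρ * t) =
      expSolution h ρ x - Complex.exp (Complex.I * ρ * x) := by
  have hadd := integrable_volterraKernel_add_mul_exp hh hL ρ x
  have hsub := integrable_volterraKernel_sub_mul_exp hh hL ρ x
  have hadd' := integrable_volterraKernel_add_mul_exp hh.neg hL.neg ρ x
  have hsub' := integrable_volterraKernel_sub_mul_exp hh.neg hL.neg ρ x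
  simp only [expKernel, mul_assoc (1 / 2 : ℂ), add_mul, sub_mul]
  rw [integral_const_mul, integral_sub (by exact (hadd.add hsub).add hsub') hadd',
    integral_add (by exact hadd.add hsub) hsub', integral_add hadd hsub, expSolution,
    jostFunction_eq_integral h ρ, jostFunction_eq_integral (-h) ρ,
    jostFunction_neg_eq_integral h ρ, jostFunction_neg_eq_integral (-h) ρ]
  ring

lemma expSolution_eq_transmutation (hh : Measurable h) (hL : MemLp h 2) (ρ : ℂ) (hx : 0 ≤ x) :
    expSolution h ρ x =
      transmutation (expKernel h) (fun t => Complex.exp (Complex.I * ρ * t)) x := by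
  rw [transmutation, intervalIntegral.integral_of_le (by linarith),
    ← integral_Icc_eq_integral_Ioc, setIntegral_eq_integral_of_forall_compl_eq_zero
      (fun t ht => by rw [expKernel_eq_zero_of_notMem ht, zero_mul]),
    integral_expKernel_mul_exp hh hL, add_sub_cancel]

lemma measurable_expKernel (hh : Measurable h) (hL : MemLp h 2) :
    Measurable (Function.uncurry (expKernel h)) := by
  have hS := measurable_volterraKernel hh hL
  have hS' := measurable_volterraKernel hh.neg hL.neg
  have hadd : Measurable fun p : ℝ × ℝ => (p.1, p.1 + p.2) := by fun_prop
  have hsub : Measurable fun p : ℝ × ℝ => (p.1, p.1 - p.2) := by fun_prop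
  exact ((((hS.comp hadd).add (hS.comp hsub)).add (hS'.comp hsub)).sub (hS'.comp hadd)).const_mul _

lemma exists_norm_expKernel_le (hh : Measurable h) (hL : MemLp h 2) (ℓ : ℝ) :
    ∃ g : ℝ → ℝ, Integrable g ∧ MemLp g 2 ∧
      ∀ x ≤ ℓ, ∀ t, ‖expKernel h x t‖ ≤ g (x + t) + g (x - t) := by
  obtain ⟨g, hg, hg₂, hle⟩ := exists_norm_volterraKernel_le hh hL ℓ
  obtain ⟨g', hg', hg₂', hle'⟩ := exists_norm_volterraKernel_le hh.neg hL.neg ℓ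
  refine ⟨g + g', hg.add hg', hg₂.add hg₂', fun x hx t => ?_⟩
  have hadd := hle x hx (x + t)
  have hsub := hle x hx (x - t)
  have hadd' := hle' x hx (x + t)
  have hsub' := hle' x hx (x - t)
  rw [expKernel, norm_mul, show ‖(1 / 2 : ℂ)‖ = 1 / 2 by norm_num]
  have htri := norm_sub_le_of_le
    (norm_add_le_of_le (norm_add_le_of_le hadd hsub) hsub') hadd'
  have hnonneg := (norm_nonneg _).trans htri
  simp only [Pi.add_apply]
  linarith

lemma exists_integral_norm_expKernel_le (hh : Measurable h) (hL : MemLp h 2) (ℓ : ℝ) :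
    ∃ C : ℝ, ∀ x ∈ Icc 0 ℓ, IntervalIntegrable (expKernel h x) volume (-x) x ∧
      ∫ t in (-x)..x, ‖expKernel h x t‖ ≤ C := by
  obtain ⟨g, hg, -, hle⟩ := exists_norm_expKernel_le hh hL ℓ
  refine ⟨(∫ t, g t) + ∫ t, g t, fun x hx => ?_⟩
  have hmaj : Integrable fun t => g (x + t) + g (x - t) :=
    (hg.comp_add_left x).add (hg.comp_sub_left x)
  have hint : Integrable (expKernel h x) :=
    hmaj.mono' (measurable_expKernel hh hL).of_uncurry_left.aestronglyMeasurable
      (Eventually.of_forall (hle x hx.2))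
  refine ⟨hint.intervalIntegrable, ?_⟩
  calc ∫ t in (-x)..x, ‖expKernel h x t‖
      ≤ ∫ t, ‖expKernel h x t‖ := by
        rw [intervalIntegral.integral_of_le (neg_le_self hx.1)]
        exact setIntegral_le_integral hint.norm (Eventually.of_forall fun t => norm_nonneg _)
    _ ≤ ∫ t, (g (x + t) + g (x - t)) := integral_mono hint.norm hmaj (hle x hx.2)
    _ = (∫ t, g t) + ∫ t, g t := by
        rw [integral_add (hg.comp_add_left x) (hg.comp_sub_left x), integral_add_left_eq_self,
          integral_sub_left_eq_self g volume x]

lemma exists_eLpNorm_expKernel_le (hh : Measurable h) (hL : MemLp h 2) (ℓ : ℝ) :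
    ∃ C : ENNReal, C ≠ ⊤ ∧ ∀ x ≤ ℓ, eLpNorm (expKernel h x) 2 ≤ C := by
  obtain ⟨g, -, hg, hle⟩ := exists_norm_expKernel_le hh hL ℓ
  exact ⟨_, ENNReal.add_ne_top.2 ⟨hg.2.ne, hg.2.ne⟩, fun x hx =>
    (eLpNorm_mono_real (hle x hx)).trans (eLpNorm_comp_add_comp_sub_le one_le_two hg.1 x)⟩

lemma memLp_expKernel (hh : Measurable h) (hL : MemLp h 2) (x : ℝ) : MemLp (expKernel h x) 2 := by
  obtain ⟨C, hC, hle⟩ := exists_eLpNorm_expKernel_le hh hL x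
  exact ⟨(measurable_expKernel hh hL).of_uncurry_left.aestronglyMeasurable,
    (hle x le_rfl).trans_lt hC.lt_top⟩

lemma memLp_expKernel_triangle (hh : Measurable h) (hL : MemLp h 2) (ℓ : ℝ) :
    MemLp (fun p : ℝ × ℝ => expKernel h p.1 p.2) 2 (volume.restrict (triangle ℓ)) := by
  obtain ⟨C, hC, hle⟩ := exists_eLpNorm_expKernel_le hh hL ℓ
  have hsub : triangle ℓ ⊆ Icc 0 ℓ ×ˢ univ := fun p hp => ⟨⟨hp.1, hp.2.1⟩, mem_univ _⟩
  refine MemLp.mono_measure (Measure.restrict_mono_set _ hsub) ?_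
  rw [Measure.volume_eq_prod, ← Measure.prod_restrict, Measure.restrict_univ]
  refine memLp_prod_of_eLpNorm_le two_ne_zero ENNReal.ofNat_ne_top hC
    (measurable_expKernel hh hL).aestronglyMeasurable ?_
  filter_upwards [ae_restrict_mem measurableSet_Icc] with x hx using hle x hx.2

lemma isTransmutationKernel_expKernel {σ f f' : ℝ → ℂ} (hℓ : 0 ≤ ℓ)
    (hf : IsNonvanishingSolution ℓ σ f) (hf' : HasL2Deriv ℓ f f') (hh : Measurable h)
    (hL : MemLp h 2) (hhf : h =ᵐ[volume.restrict (Ioo 0 ℓ)] fun x => f' x / f x) :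
    IsTransmutationKernel ℓ σ f (expKernel h) :=
  ⟨memLp_expKernel_triangle hh hL ℓ, fun x _ => (memLp_expKernel hh hL x).restrict _,
    fun ρ => ⟨expSolution h ρ, isExpSolution_expSolution hℓ hf hf' hh hL hhf ρ,
      fun _ hx => expSolution_eq_transmutation hh hL ρ hx.1.le⟩⟩

lemma continuousOn_transmutation_expKernel_exp (hh : Measurable h) (hL : MemLp h 2) (ρ : ℂ)
    (ℓ : ℝ) :
    ContinuousOn (transmutation (expKernel h) fun t => Complex.exp (Complex.I * ρ * t))
      (Icc 0 ℓ) :=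
  (hasL2Deriv_expSolution hh hL ρ ℓ).continuousOn.congr fun _ hx =>
    (expSolution_eq_transmutation hh hL ρ hx.1).symm

end ExpKernel

section BoundedFamilies

variable {X 𝕜 E F : Type*} [TopologicalSpace X] [NontriviallyNormedField 𝕜]
  [NormedAddCommGroup E] [NormedSpace 𝕜 E] [NormedAddCommGroup F] [NormedSpace 𝕜 F]
  {T : X → E →L[𝕜] F} {C : ℝ}

lemma continuous_clm_apply_of_dense_span {s : Set E}
    (hs : Dense (Submodule.span 𝕜 s : Set E)) (hC : ∀ x, ‖T x‖ ≤ C)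
    (hT : ∀ e ∈ s, Continuous fun x => T x e) (u : E) : Continuous fun x => T x u := by
  have hbdd : ∃ C, ∀ x, ‖T x‖ ≤ C := ⟨C, hC⟩
  have hequi : Equicontinuous ((↑) ∘ T : X → E → F) :=
    ((NormedSpace.equicontinuous_TFAE T).out 5 1).1 hbdd
  refine continuous_iff_continuousAt.2 fun x₀ => ?_
  have hclosed : IsClosed {e | Tendsto (fun x => T x e) (𝓝 x₀) (𝓝 (T x₀ e))} :=
    hequi.isClosed_setOfPred_tendsto (T x₀).continuous
  have hspan : ∀ e ∈ Submodule.span 𝕜 s, Continuous fun x => T x e := fun e he => by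
    induction he using Submodule.span_induction with
    | mem e he => exact hT e he
    | zero => simpa only [map_zero] using continuous_const
    | add e e' _ _ he he' => simpa only [map_add] using! he.add he'
    | smul c e _ he => simpa only [map_smul] using! he.const_smul c
  exact hclosed.closure_subset_iff.2 (fun e he => (hspan e he).tendsto x₀) (hs u)

lemma exists_clm_continuousMap_apply_eq [CompactSpace X] (hC : ∀ x, ‖T x‖ ≤ C)
    (hT : ∀ u, Continuous fun x => T x u) :
    ∃ A : E →L[𝕜] C(X, F), ∀ u x, A u x = T x u := by
  refine ⟨LinearMap.mkContinuous
    { toFun := fun u => ⟨fun x => T x u, hT u⟩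
      map_add' := fun u w => ContinuousMap.ext fun x => map_add (T x) u w
      map_smul' := fun c u => ContinuousMap.ext fun x => map_smul (T x) c u } |C| fun u => ?_,
    fun _ _ => rfl⟩
  exact (ContinuousMap.norm_le _ (by positivity)).2 fun x =>
    (T x).le_of_opNorm_le ((hC x).trans (le_abs_self C)) u

end BoundedFamilies

section Exponentials

/-- The exponentials `t ↦ e^{irt}`, `r ∈ ℝ`, on `s`. They form a multiplicative subgroup of
`C(s, ℂ)`, which turns the algebra they generate into their linear span. -/
noncomputable def expMap (s : Set ℝ) : Multiplicative ℝ →* C(s, ℂ) where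
  toFun r := ⟨fun t => Complex.exp (Complex.I * r.toAdd * (t : ℝ)), by fun_prop⟩
  map_one' := by ext; simp
  map_mul' r r' := by
    ext t
    simp only [toAdd_mul, Complex.ofReal_add, mul_add, add_mul, Complex.exp_add,
      ContinuousMap.coe_mk, ContinuousMap.mul_apply]

variable {s : Set ℝ}

lemma expMap_apply (r : Multiplicative ℝ) (t : s) :
    expMap s r t = Complex.exp (Complex.I * r.toAdd * (t : ℝ)) := rfl

lemma star_expMap (r : Multiplicative ℝ) : star (expMap s r) = expMap s r⁻¹ := by
  ext t
  simp only [ContinuousMap.star_apply, expMap_apply, RCLike.star_def, ← Complex.exp_conj, map_mul,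
    Complex.conj_I, Complex.conj_ofReal, toAdd_inv, Complex.ofReal_neg, neg_mul, mul_neg]

lemma adjoin_range_expMap :
    Subalgebra.toSubmodule (Algebra.adjoin ℂ (range (expMap s))) =
      Submodule.span ℂ (range (expMap s)) := by
  rw [Algebra.adjoin_eq_span, ← MonoidHom.coe_mrange, Submonoid.closure_eq]

lemma exists_expMap_ne {x y : s} (hxy : x ≠ y) : ∃ r, expMap s r x ≠ expMap s r y := by
  have hne : ((x : ℝ) : ℂ) - (y : ℝ) ≠ 0 := by
    exact_mod_cast sub_ne_zero.2 (Subtype.coe_ne_coe.2 hxy)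
  refine ⟨.ofAdd (Real.pi / (x - y)), fun h => ?_⟩
  have hsub : Complex.I * (Real.pi / (x - y) : ℝ) * (x : ℝ) =
      Complex.I * (Real.pi / (x - y) : ℝ) * (y : ℝ) + Real.pi * Complex.I := by
    push_cast
    field_simp
    ring
  rw [expMap_apply, expMap_apply, toAdd_ofAdd, hsub, Complex.exp_add, Complex.exp_pi_mul_I,
    mul_neg_one, neg_eq_self] at h
  exact Complex.exp_ne_zero _ h

/-- The star subalgebra of `C(s, ℂ)` generated by the exponentials, to which the
Stone–Weierstrass theorem applies. -/
noncomputable def expSubalgebra (s : Set ℝ) : StarSubalgebra ℂ C(s, ℂ) where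
  toSubalgebra := Algebra.adjoin ℂ (range (expMap s))
  star_mem' := by
    change Algebra.adjoin ℂ (range (expMap s)) ≤ star (Algebra.adjoin ℂ (range (expMap s)))
    refine Algebra.adjoin_le ?_
    rintro - ⟨r, rfl⟩
    exact Algebra.subset_adjoin ⟨r⁻¹, (star_expMap r).symm⟩

lemma dense_span_range_expMap [CompactSpace s] :
    Dense (Submodule.span ℂ (range (expMap s)) : Set C(s, ℂ)) := by
  have hsep : (expSubalgebra s).SeparatesPoints := fun x y hxy => by
    obtain ⟨r, hr⟩ := exists_expMap_ne hxy
    exact ⟨_, ⟨expMap s r, Algebra.subset_adjoin ⟨r, rfl⟩, rfl⟩, hr⟩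
  rw [Submodule.dense_iff_topologicalClosure_eq_top, ← adjoin_range_expMap]
  exact congr_arg (Subalgebra.toSubmodule <| StarSubalgebra.toSubalgebra ·)
    (ContinuousMap.starSubalgebra_topologicalClosure_eq_top_of_separatesPoints _ hsep)

end Exponentials

section Transmutation

variable {K : ℝ → ℝ → ℂ} {u w : ℝ → ℂ} {x ℓ : ℝ}

lemma transmutation_congr (hx : 0 ≤ x) (huw : EqOn u w (Icc (-x) x)) :
    transmutation K u x = transmutation K w x := by
  rw [transmutation, transmutation, huw ⟨neg_le_self hx, le_rfl⟩]
  congr 1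
  refine intervalIntegral.integral_congr fun t ht => ?_
  rw [uIcc_of_le (neg_le_self hx)] at ht
  simp only [huw ht]

lemma transmutation_add (hu : IntervalIntegrable (fun t => K x t * u t) volume (-x) x)
    (hw : IntervalIntegrable (fun t => K x t * w t) volume (-x) x) :
    transmutation K (u + w) x = transmutation K u x + transmutation K w x := by
  simp only [transmutation, Pi.add_apply, mul_add]
  rw [intervalIntegral.integral_add hu hw, add_add_add_comm]

lemma transmutation_const_smul (c : ℂ) :
    transmutation K (c • u) x = c • transmutation K u x := by
  simp only [transmutation, Pi.smul_apply, mul_smul_comm, intervalIntegral.integral_smul, smul_add]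

lemma norm_transmutation_le {M : ℝ} (hx : 0 ≤ x)
    (hK : IntervalIntegrable (K x) volume (-x) x) (hu : ∀ t, ‖u t‖ ≤ M) :
    ‖transmutation K u x‖ ≤ (1 + ∫ t in (-x)..x, ‖K x t‖) * M := by
  rw [add_mul, one_mul, ← intervalIntegral.integral_mul_const]
  refine norm_add_le_of_le (hu x) (intervalIntegral.norm_integral_le_of_norm_le (neg_le_self hx)
    (Eventually.of_forall fun t _ => ?_) (hK.norm.mul_const _))
  rw [norm_mul]
  gcongr
  exact hu t

/-- The functional `u ↦ u(x) + ∫_{-x}^{x} K(x,t) u(t) dt` on `C[a,b]`, with `u` extended by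
constants beyond the endpoints. -/
noncomputable def transmutationFunctional {a b : ℝ} (hab : a ≤ b) (hx : 0 ≤ x)
    (hK : IntervalIntegrable (K x) volume (-x) x) : C(Icc a b, ℂ) →L[ℂ] ℂ :=
  have hint (u : C(Icc a b, ℂ)) :
      IntervalIntegrable (fun t => K x t * IccExtend hab u t) volume (-x) x :=
    hK.mul_continuousOn u.continuous.Icc_extend'.continuousOn
  LinearMap.mkContinuous
    { toFun := fun u => transmutation K (IccExtend hab u) x
      map_add' := fun u w => transmutation_add (hint u) (hint w)
      map_smul' := fun c _ => transmutation_const_smul c }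
    (1 + ∫ t in (-x)..x, ‖K x t‖)
    fun u => norm_transmutation_le hx hK fun _ => u.norm_coe_le_norm _

lemma transmutationFunctional_apply {a b : ℝ} (hab : a ≤ b) (hx : 0 ≤ x)
    (hK : IntervalIntegrable (K x) volume (-x) x) (u : C(Icc a b, ℂ)) :
    transmutationFunctional hab hx hK u = transmutation K (IccExtend hab u) x := rfl

lemma norm_transmutationFunctional_le {a b : ℝ} (hab : a ≤ b) (hx : 0 ≤ x)
    (hK : IntervalIntegrable (K x) volume (-x) x) :
    ‖transmutationFunctional hab hx hK‖ ≤ 1 + ∫ t in (-x)..x, ‖K x t‖ :=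
  LinearMap.mkContinuous_norm_le _
    (add_nonneg zero_le_one (intervalIntegral.integral_nonneg (neg_le_self hx)
      fun _ _ => norm_nonneg _)) fun u => norm_transmutation_le hx hK fun _ => u.norm_coe_le_norm _

lemma transmutation_iccExtend_expMap (hℓ : -ℓ ≤ ℓ) (hx : x ∈ Icc 0 ℓ) (r : Multiplicative ℝ) :
    transmutation K (IccExtend hℓ (expMap (Icc (-ℓ) ℓ) r)) x =
      transmutation K (fun t => Complex.exp (Complex.I * r.toAdd * t)) x :=
  transmutation_congr hx.1 fun t ht => by
    rw [IccExtend_of_mem _ _ ⟨(neg_le_neg hx.2).trans ht.1, ht.2.trans hx.2⟩, expMap_apply]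

lemma transmutation_eq_of_exp {K' : ℝ → ℝ → ℂ} (hx : 0 ≤ x)
    (hK : IntervalIntegrable (K x) volume (-x) x) (hK' : IntervalIntegrable (K' x) volume (-x) x)
    (hexp : ∀ r : ℝ, transmutation K (fun t => Complex.exp (Complex.I * r * t)) x =
      transmutation K' (fun t => Complex.exp (Complex.I * r * t)) x)
    (hu : ContinuousOn u (Icc (-x) x)) : transmutation K u x = transmutation K' u x := by
  have hx' := neg_le_self hx
  have hfun : transmutationFunctional hx' hx hK = transmutationFunctional hx' hx hK' := by
    refine ContinuousLinearMap.ext_on dense_span_range_expMap ?_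
    rintro - ⟨r, rfl⟩
    simp only [transmutationFunctional_apply, transmutation_iccExtend_expMap hx' ⟨hx, le_rfl⟩, hexp]
  have hext : EqOn u (IccExtend hx' ((Icc (-x) x).domRestrict u)) (Icc (-x) x) := fun t ht =>
    (IccExtend_of_mem hx' ((Icc (-x) x).domRestrict u) ht).symm
  rw [transmutation_congr hx hext, transmutation_congr hx hext]
  exact DFunLike.congr_fun hfun ⟨_, hu.domRestrict⟩

lemma exists_transmutationCLM {C : ℝ} (hℓ : -ℓ ≤ ℓ)
    (hK : ∀ x ∈ Icc 0 ℓ, IntervalIntegrable (K x) volume (-x) x ∧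
      ∫ t in (-x)..x, ‖K x t‖ ≤ C)
    (hexp : ∀ r : ℝ,
      ContinuousOn (transmutation K fun t => Complex.exp (Complex.I * r * t)) (Icc 0 ℓ)) :
    ∃ T : C(Icc (-ℓ) ℓ, ℂ) →L[ℂ] C(Icc (0 : ℝ) ℓ, ℂ),
      ∀ u x, T u x = transmutation K (IccExtend hℓ u) x := by
  let T (x : Icc (0 : ℝ) ℓ) : C(Icc (-ℓ) ℓ, ℂ) →L[ℂ] ℂ :=
    transmutationFunctional hℓ x.2.1 (hK x x.2).1
  have hT (x : Icc (0 : ℝ) ℓ) : ‖T x‖ ≤ 1 + C :=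
    (norm_transmutationFunctional_le hℓ x.2.1 _).trans (by gcongr; exact (hK x x.2).2)
  refine exists_clm_continuousMap_apply_eq hT
    (continuous_clm_apply_of_dense_span dense_span_range_expMap hT ?_)
  rintro - ⟨r, rfl⟩
  refine (hexp r.toAdd).domRestrict.congr fun x => ?_
  exact (transmutation_iccExtend_expMap hℓ x.2 r).symm

end Transmutation

lemma IsTransmutationKernel.intervalIntegrable {ℓ x : ℝ} {σ f : ℝ → ℂ} {K : ℝ → ℝ → ℂ}
    (hK : IsTransmutationKernel ℓ σ f K) (hx : x ∈ Ioc 0 ℓ) :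
    IntervalIntegrable (K x) volume (-x) x := by
  rw [intervalIntegrable_iff_integrableOn_Ioo_of_le (neg_le_self hx.1.le)]
  exact (hK.memLp_slice x hx).integrable one_le_two

lemma IsTransmutationKernel.transmutation_eq {ℓ x : ℝ} {σ f u : ℝ → ℂ} {K K' : ℝ → ℝ → ℂ}
    (hK : IsTransmutationKernel ℓ σ f K) (hK' : IsTransmutationKernel ℓ σ f K')
    (hf : IsNonvanishingSolution ℓ σ f) (hx : x ∈ Icc 0 ℓ) (hu : ContinuousOn u (Icc (-x) x)) :
    transmutation K u x = transmutation K' u x := by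
  rcases hx.1.eq_or_lt with rfl | hx₀
  · simp only [transmutation, neg_zero, intervalIntegral.integral_same]
  have hx' : x ∈ Ioc 0 ℓ := ⟨hx₀, hx.2⟩
  refine transmutation_eq_of_exp hx.1 (hK.intervalIntegrable hx') (hK'.intervalIntegrable hx')
    (fun r => ?_) hu
  obtain ⟨e, he, hrepr⟩ := hK.repr r
  obtain ⟨e', he', hrepr'⟩ := hK'.repr r
  rw [← hrepr x hx', ← hrepr' x hx']
  exact he.eqOn (hx.1.trans hx.2) hf he' hx

lemma memLp_logDeriv {ℓ : ℝ} {f f' : ℝ → ℂ} (hf' : HasL2Deriv ℓ f f')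
    (hne : ∀ x ∈ Icc 0 ℓ, f x ≠ 0) :
    MemLp (fun x => f' x / f x) 2 (volume.restrict (Ioo 0 ℓ)) := by
  simpa only [div_eq_inv_mul] using!
    memLp_Ioo_continuousOn_mul (hf'.continuousOn.inv₀ hne) hf'.memLp

end DistSchrodinger

theorem mainTheorem12 (ℓ : ℝ) (hℓ : 0 < ℓ) (σ f : ℝ → ℂ)
    (hσ : MeasureTheory.MemLp σ 2 (MeasureTheory.volume.restrict (Set.Ioo 0 ℓ)))
    (hf : DistSchrodinger.IsNonvanishingSolution ℓ σ f) :
    (∃ K : ℝ → ℝ → ℂ, DistSchrodinger.IsTransmutationKernel ℓ σ f K) ∧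
    ∀ K : ℝ → ℝ → ℂ, DistSchrodinger.IsTransmutationKernel ℓ σ f K →
      (∀ u : ℝ → ℂ, ContinuousOn u (Set.Icc (-ℓ) ℓ) →
        ContinuousOn (DistSchrodinger.transmutation K u) (Set.Icc 0 ℓ)) ∧
      ∃ T : C(Set.Icc (-ℓ) ℓ, ℂ) →L[ℂ] C(Set.Icc (0 : ℝ) ℓ, ℂ),
        ∀ (u : C(Set.Icc (-ℓ) ℓ, ℂ)) (x : Set.Icc (0 : ℝ) ℓ),
          T u x = DistSchrodinger.transmutation K
            (Set.IccExtend (neg_le_self hℓ.le) u) x := by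
  open DistSchrodinger in
  obtain ⟨f', hf', -⟩ := hf.solves
  obtain ⟨h, hh, hL, hhf⟩ :=
    exists_measurable_memLp_ae_eq measurableSet_Ioo (memLp_logDeriv hf' hf.ne_zero)
  have hE := isTransmutationKernel_expKernel hℓ.le hf hf' hh hL hhf
  obtain ⟨C, hC⟩ := exists_integral_norm_expKernel_le hh hL ℓ
  obtain ⟨T, hT⟩ := exists_transmutationCLM (neg_le_self hℓ.le) hC fun r =>
    continuousOn_transmutation_expKernel_exp hh hL r ℓ
  refine ⟨⟨_, hE⟩, fun K hK => ?_⟩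
  have hTK (u : C(Icc (-ℓ) ℓ, ℂ)) (x : Icc (0 : ℝ) ℓ) :
      T u x = transmutation K (IccExtend (neg_le_self hℓ.le) u) x :=
    (hT u x).trans (hE.transmutation_eq hK hf x.2 u.continuous.Icc_extend'.continuousOn)
  refine ⟨fun u hu => ?_, T, hTK⟩
  refine continuousOn_iff_continuous_domRestrict.2
    ((T ⟨(Icc (-ℓ) ℓ).domRestrict u, hu.domRestrict⟩).continuous.congr fun x => ?_)
  rw [hTK]
  refine transmutation_congr x.2.1 fun t ht => IccExtend_of_mem _ _ ?_
  exact ⟨(neg_le_neg x.2.2).trans ht.1, ht.2.trans x.2.2⟩
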